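/- Let $p$ be an odd prime. A root lattice is a finitely generated free abelian group $R$ with a positive definite symmetric bilinear form $(\cdot,\cdot):R\times R\to\mathbb Z$ that is generated by its roots, i.e. by the vectors $\alpha\in R$ with $(\alpha,\alpha)=2$. Its Weyl group $W(R)$ is the subgroup of $\operatorname{Aut}(R)$ generated by the reflections $x\mapsto x-(\alpha,x)\alpha$ in the roots $\alpha$. The lattice $R$ is said to be of type $A_m$ ($m\ge 1$), $D_m$ ($m\ge 4$) or $E_m$ ($m=6,7,8$) if it has a $\mathbb Z$-basis whose Gram matrix is the Cartan matrix of that type. Let $H$ be a finite group acting faithfully on a root lattice $R$ by lattice automorphisms (preserving the form), so that $H$ is regarded as a subgroup of $\operatorname{Aut}(R)$. Let $R_H^{\#}\subseteq R$ be the sublattice generated by $pR$ and all elements $g\alpha-\alpha$ with $g\in H$, $\alpha\in R$. The pair $(H,R)$ is called a $p$-root pair if $R_H^{\#}$ contains no roots and $R^H=\{0\}$. **Theorem.** Let $(H,R)$ be a $p$-root pair. Then: 1. If $R$ is of type $A_m$, then $m+1$ is a power of $p$. 2. $R$ is not of type $D_m$ for any $m\ge 5$; if $R$ is of type $D_4$,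 then $p=3$. 3. If $p\ge 7$, then $R$ is not of type $E_6$, $E_7$ or $E_8$; more generally, no orthogonal direct summand of $R$ is of one of these types. 4. $H\cap W(R)$ is a $p$-group. -/

import Mathlib

/-- `B` makes the finitely generated free abelian group `L` into a root lattice: the form is
symmetric and positive definite, and `L` is generated by its roots, the vectors of norm `2`.
(Such a lattice is automatically even.) -/
structure IsRootLattice {L : Type*} [AddCommGroup L] [Module.Free ℤ L] [Module.Finite ℤ L]
    (B : LinearMap.BilinForm ℤ L) : Prop where
  symm : ∀ x y, B x y = B y x
  posDef : ∀ x, x ≠ 0 → 0 < B x x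
  span_roots : Submodule.span ℤ {α : L | B α α = 2} = ⊤

/-- The Weyl group of the lattice `(L, B)`: the group of automorphisms generated by the
reflections `x ↦ x - B α x • α` in the roots `α`. -/
def weylGroup {L : Type*} [AddCommGroup L] (B : LinearMap.BilinForm ℤ L) :
    Subgroup (L ≃ₗ[ℤ] L) :=
  Subgroup.closure {s | ∃ (α : L) (h : B α α = 2), s = Module.reflection h}

/-- The sublattice generated by `p L` and all `g α - α` with `g ∈ H`, `α ∈ L`, for an action
`ρ` of `H` on `L`. -/
def sharpLattice {L H : Type*} [AddCommGroup L] [Group H] (p : ℕ) (ρ : H →* (L ≃ₗ[ℤ] L)) :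
    Submodule ℤ L :=
  Submodule.span ℤ ({x | ∃ α : L, x = (p : ℤ) • α} ∪ {x | ∃ (g : H) (α : L), x = ρ g α - α})

/-- `(H, L)` is a pseudo `p`-root pair: the finite group `H` acts faithfully, through `ρ`, on the
root lattice `(L, B)` by lattice automorphisms, and `sharpLattice p ρ` contains no roots. -/
structure IsPseudoRootPair {L H : Type*} [AddCommGroup L] [Module.Free ℤ L] [Module.Finite ℤ L]
    [Group H] [Finite H] (p : ℕ) (B : LinearMap.BilinForm ℤ L) (ρ : H →* (L ≃ₗ[ℤ] L)) : Prop where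
  isRootLattice : IsRootLattice B
  isometry : ∀ (g : H) (x y : L), B (ρ g x) (ρ g y) = B x y
  faithful : Function.Injective ρ
  no_roots : ∀ x ∈ sharpLattice p ρ, B x x ≠ 2

/-- `(H, L)` is a `p`-root pair: a pseudo `p`-root pair without nonzero `H`-fixed vectors. -/
structure IsRootPair {L H : Type*} [AddCommGroup L] [Module.Free ℤ L] [Module.Finite ℤ L]
    [Group H] [Finite H] (p : ℕ) (B : LinearMap.BilinForm ℤ L) (ρ : H →* (L ≃ₗ[ℤ] L)) : Prop
    extends IsPseudoRootPair p B ρ where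
  fixed_eq_zero : ∀ x : L, (∀ g : H, ρ g x = x) → x = 0

/-- The lattice `(L, B)` has the Cartan matrix `C` (`A_m`, `D_m`, `E_6`, `E_7`, `E_8`): it has a
`ℤ`-basis (of simple roots) with Gram matrix `C`. -/
def HasType {L ι : Type*} [AddCommGroup L] (B : LinearMap.BilinForm ℤ L)
    (C : Matrix ι ι ℤ) : Prop :=
  ∃ b : Module.Basis ι ℤ L, ∀ i j, B (b i) (b j) = C i j

/-- `(L, B)` is of type `E_6`, `E_7` or `E_8`. -/
def HasTypeE {L : Type*} [AddCommGroup L] (B : LinearMap.BilinForm ℤ L) : Prop :=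
  HasType B CartanMatrix.E₆ ∨ HasType B CartanMatrix.E₇ ∨ HasType B CartanMatrix.E₈

/-- `(L, B)` is the orthogonal direct sum of the sublattice `M` and some sublattice `N`.
(For a definite form, orthogonal sublattices intersect in `0`, so the sum is direct.) -/
def IsOrthogonalSummand {L : Type*} [AddCommGroup L] (B : LinearMap.BilinForm ℤ L)
    (M : Submodule ℤ L) : Prop :=
  ∃ N : Submodule ℤ L, M ⊔ N = ⊤ ∧ ∀ x ∈ M, ∀ y ∈ N, B x y = 0

/-! Call a vector regular if it is orthogonal to no root. A subgroup `K` of `H` of order prime to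
`p` always fixes a regular vector: if the `K`-orbit sum of a root `α` vanished, then `|K| α`, and
hence `α`, would lie in the sharp lattice. Since the Weyl group acts freely on regular vectors,
elements of `H ∩ W` have trivial `p'`-part, which is claim 4. Since `H` fixes no nonzero vector, it
must contain an element of order `p` as soon as there is a root.

For `E₇` and `E₈` the Dynkin diagram is rigid, so every isometry fixing a regular vector is trivial
and `H` is a `p`-group. A `p`-group without nonzero fixed vectors forces `p - 1` to divide the rank,
which excludes `p ≥ 7`. For `E₆` an element of order `p ≥ 7` has norm map zero on a lattice of rank
6, yet acts trivially on the one-dimensional radical modulo 3. A summand of type `E` inherits the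
root pair from its stabilizer.

For `D_m` an element of order `p` sends each `2 e_i` to a vector with even coordinates, by norm if
`m ≥ 5` and by pigeonhole on four classes if `m = 4`, `p ≥ 5`. It then acts by signs, so its square
is trivial. For `A_m` with `m ≥ 2`, isometries are signed permutations of the `m + 1` coordinates;
the classes of `e_i - e_0` modulo the sharp lattice are distinct and form a subgroup of an
elementary abelian `p`-group. -/

section CommonNonvanishing

/-- Perturb `x` to `x + k • y` with `k` larger than every `|f i x|`: the multiple `k * f i y` cannot
cancel `f i x` unless both vanish. -/
theorem LinearMap.exists_mem_forall_apply_ne_zero {ι L : Type*} [AddCommGroup L]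
    (V : Submodule ℤ L) (s : Finset ι) (f : ι → L →ₗ[ℤ] ℤ)
    (h : ∀ i ∈ s, ∃ x ∈ V, f i x ≠ 0) : ∃ x ∈ V, ∀ i ∈ s, f i x ≠ 0 := by
  classical
  induction s using Finset.induction_on with
  | empty => exact ⟨0, V.zero_mem, by simp⟩
  | insert a s ha ih =>
    obtain ⟨x, hxV, hx⟩ := ih fun i hi => h i (Finset.mem_insert_of_mem hi)
    obtain ⟨y, hyV, hy⟩ := h a (Finset.mem_insert_self a s)
    set k : ℤ := 1 + ∑ i ∈ insert a s, |f i x| with hk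
    have hlt : ∀ i ∈ insert a s, |f i x| < k := fun i hi => by
      have : |f i x| ≤ ∑ i ∈ insert a s, |f i x| :=
        Finset.single_le_sum (f := fun i => |f i x|) (fun j _ => abs_nonneg _) hi
      omega
    refine ⟨x + k • y, V.add_mem hxV (V.smul_mem _ hyV), fun i hi h0 => ?_⟩
    have hxi := hlt i hi
    have hk0 : 0 < k := (abs_nonneg _).trans_lt hxi
    have hkey : f i y = 0 := by
      by_contra hne
      have h1 : f i x = -(k * f i y) := by
        have : f i x + k * f i y = 0 := by simpa using h0
        linarith
      rw [h1, abs_neg, abs_mul, abs_of_pos hk0] at hxi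
      nlinarith [Int.one_le_abs hne]
    have hx0 : f i x = 0 := by simpa [hkey] using h0
    rcases Finset.mem_insert.mp hi with rfl | hi'
    · exact hy hkey
    · exact hx i hi' hx0

end CommonNonvanishing

/-- A reflection is conjugated by an isometry to the reflection in the image root. -/
theorem LinearEquiv.conj_reflection {L : Type*} [AddCommGroup L] {B : LinearMap.BilinForm ℤ L}
    {w : L ≃ₗ[ℤ] L} (hw : ∀ x y, B (w x) (w y) = B x y)
    {α β : L} (hα : B α α = 2) (hβ : B β β = 2) (h : w α = β) :
    Module.reflection hβ * w = w * Module.reflection hα := by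
  ext x
  simp only [LinearEquiv.mul_apply, Module.reflection_apply, map_sub, map_smul, ← h, hw]

/-! ### Elementary properties of root lattices -/

namespace IsRootLattice

variable {L : Type*} [AddCommGroup L] [Module.Free ℤ L] [Module.Finite ℤ L]
  {B : LinearMap.BilinForm ℤ L}

theorem self_nonneg (hB : IsRootLattice B) (x : L) : 0 ≤ B x x := by
  by_cases h : x = 0
  · simp [h]
  · exact (hB.posDef x h).le

theorem eq_zero_of_self (hB : IsRootLattice B) {x : L} (h : B x x = 0) : x = 0 := by
  by_contra hx
  exact (hB.posDef x hx).ne' h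

theorem self_add (hB : IsRootLattice B) (x y : L) :
    B (x + y) (x + y) = B x x + 2 * B x y + B y y := by
  simp only [map_add, LinearMap.add_apply, hB.symm y x]
  ring

theorem self_sub (hB : IsRootLattice B) (x y : L) :
    B (x - y) (x - y) = B x x - 2 * B x y + B y y := by
  simp only [map_sub, LinearMap.sub_apply, hB.symm y x]
  ring

theorem even_self (hB : IsRootLattice B) (x : L) : Even (B x x) := by
  have hx : x ∈ Submodule.span ℤ {α : L | B α α = 2} := hB.span_roots ▸ Submodule.mem_top
  induction hx using Submodule.span_induction with
  | mem x h => rw [Set.mem_ofPred_eq.mp h]; exact even_two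
  | zero => simp
  | add x y _ _ hx hy =>
    rw [hB.self_add]
    exact (hx.add (even_two_mul _)).add hy
  | smul a x _ hx =>
    simp only [map_smul, LinearMap.smul_apply, smul_eq_mul]
    exact (hx.mul_left _).mul_left _

theorem two_le_self (hB : IsRootLattice B) {x : L} (hx : x ≠ 0) : 2 ≤ B x x := by
  obtain ⟨k, hk⟩ := hB.even_self x
  have := hB.posDef x hx
  omega

/-- A vector is determined by its pairings with a basis, and these are bounded because the norms of
`x ± b i` are nonnegative. -/
theorem finite_setOf_self_eq (hB : IsRootLattice B) (n : ℤ) : {x : L | B x x = n}.Finite := by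
  let b := Module.Free.chooseBasis ℤ L
  have hinj : Function.Injective (fun (x : L) i => B x (b i)) := by
    intro x y hxy
    have h0 : B (x - y) = 0 := b.ext fun i => by
      simpa [sub_eq_zero] using congrFun hxy i
    exact sub_eq_zero.mp (hB.eq_zero_of_self (by rw [h0]; rfl))
  refine Set.Finite.of_finite_image (f := fun (x : L) i => B x (b i)) ?_ hinj.injOn
  refine Set.Finite.subset
    (Set.Finite.pi' fun i => Set.finite_Icc (-(n + B (b i) (b i))) (n + B (b i) (b i))) ?_
  rintro _ ⟨x, hx, rfl⟩ i
  have h1 := hB.self_nonneg (x + b i)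
  have h2 := hB.self_nonneg (x - b i)
  rw [hB.self_add] at h1
  rw [hB.self_sub] at h2
  have h3 := hB.self_nonneg (b i)
  have h4 := hB.self_nonneg x
  rw [Set.mem_ofPred_eq] at hx
  constructor <;> dsimp only <;> linarith

theorem reflection_isometry (hB : IsRootLattice B) {α : L} (h : B α α = 2) (x y : L) :
    B (Module.reflection h x) (Module.reflection h y) = B x y := by
  simp only [Module.reflection_apply, map_sub, map_smul, LinearMap.sub_apply, LinearMap.smul_apply,
    smul_eq_mul, h, hB.symm x α]
  ring

theorem isometry_of_mem_weylGroup (hB : IsRootLattice B) {w : L ≃ₗ[ℤ] L} (hw : w ∈ weylGroup B) :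
    ∀ x y, B (w x) (w y) = B x y := by
  induction hw using Subgroup.closure_induction with
  | mem w h =>
    obtain ⟨α, hα, rfl⟩ := h
    exact hB.reflection_isometry hα
  | one => simp
  | mul u v _ _ hu hv => intro x y; rw [LinearEquiv.mul_apply, LinearEquiv.mul_apply, hu, hv]
  | inv u _ hu =>
    intro x y
    rw [← hu, ← LinearEquiv.mul_apply, ← LinearEquiv.mul_apply, mul_inv_cancel]
    rfl

end IsRootLattice

/-! ### Simple reflections and free action of the Weyl group on regular vectors -/

section Chamber

variable {L : Type*} [AddCommGroup L]

/-- The roots that are positive with respect to `v`. -/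
def IsPositiveRoot (B : LinearMap.BilinForm ℤ L) (v α : L) : Prop :=
  B α α = 2 ∧ 0 < B v α

/-- The positive roots that are not sums of two positive roots. -/
def IsSimpleRoot (B : LinearMap.BilinForm ℤ L) (v α : L) : Prop :=
  IsPositiveRoot B v α ∧
    ∀ β γ, IsPositiveRoot B v β → IsPositiveRoot B v γ → β + γ ≠ α

/-- The product of the reflections in the simple roots of a word. -/
def simpleWord (B : LinearMap.BilinForm ℤ L) (v : L) (l : List {α // IsSimpleRoot B v α}) :
    L ≃ₗ[ℤ] L :=
  (l.map fun α => Module.reflection α.2.1.1).prod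

variable [Module.Free ℤ L] [Module.Finite ℤ L] {B : LinearMap.BilinForm ℤ L} {v : L}

namespace IsRootLattice

theorem simpleWord_isometry (hB : IsRootLattice B) (l : List {α // IsSimpleRoot B v α}) :
    ∀ x y, B (simpleWord B v l x) (simpleWord B v l y) = B x y := by
  induction l with
  | nil => simp [simpleWord]
  | cons α l ih =>
    intro x y
    have : simpleWord B v (α :: l) = Module.reflection α.2.1.1 * simpleWord B v l := by
      simp [simpleWord]
    rw [this, LinearEquiv.mul_apply, LinearEquiv.mul_apply, hB.reflection_isometry, ih]

/-- By definiteness `B α β` is -1, 0 or 1. Only 1 is delicate: then `α - β` is a root, and if it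
were positive, `α = β + (α - β)` would not be simple. -/
theorem reflection_pos (hB : IsRootLattice B) (hv : ∀ α, B α α = 2 → B v α ≠ 0) {α β : L}
    (hα : IsSimpleRoot B v α) (hβ : IsPositiveRoot B v β) (hne : β ≠ α) :
    0 < B v (Module.reflection hα.1.1 β) := by
  have h1 : 0 < B (α - β) (α - β) := hB.posDef _ (sub_ne_zero.mpr hne.symm)
  have hvp : 0 < B v (α + β) := by
    rw [map_add]; exact add_pos hα.1.2 hβ.2
  have h2 : 0 < B (α + β) (α + β) := hB.posDef _ fun h => by simp [h] at hvp
  have hα2 := hα.1.1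
  have hβ2 := hβ.1
  have hd := hB.self_sub α β
  rw [hB.self_sub] at h1
  rw [hB.self_add] at h2
  have hc : B α β = -1 ∨ B α β = 0 ∨ B α β = 1 := by omega
  rw [Module.reflection_apply]
  rcases hc with hc | hc | hc
  · rw [hc]
    have := hα.1.2
    have := hβ.2
    simp only [map_sub, map_smul, smul_eq_mul]
    linarith
  · rw [hc]
    simpa using hβ.2
  · rw [hc, one_smul]
    have hr : B (α - β) (α - β) = 2 := by rw [hd, hα2, hβ2, hc]; norm_num
    have h0 := hv _ hr
    by_contra hneg
    refine hα.2 β (α - β) hβ ⟨hr, ?_⟩ (by abel)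
    simp only [map_sub] at h0 hneg ⊢
    omega

/-- Induction on the height `B v β`: a positive root that is not simple is `γ + δ` with lower
heights, and its reflection is `s_γ s_δ s_γ`. -/
theorem exists_simpleWord_eq_reflection (hB : IsRootLattice B) (n : ℕ) :
    ∀ β (hβ : IsPositiveRoot B v β), B v β ≤ n →
      ∃ l, simpleWord B v l = Module.reflection hβ.1 := by
  induction n with
  | zero =>
    intro β hβ hn
    have := hβ.2
    simp only [Nat.cast_zero] at hn
    omega
  | succ n ih =>
    intro β hβ hn
    by_cases hs : IsSimpleRoot B v β
    · exact ⟨[⟨β, hs⟩], by simp [simpleWord]⟩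
    · simp only [IsSimpleRoot, hβ, true_and] at hs
      push Not at hs
      obtain ⟨γ, δ, hγ, hδ, hsum⟩ := hs
      have h1 := hγ.2
      have h2 := hδ.2
      have hv : B v γ + B v δ = B v β := by rw [← hsum, map_add]
      push_cast at hn
      obtain ⟨l₁, e₁⟩ := ih γ hγ (by omega)
      obtain ⟨l₂, e₂⟩ := ih δ hδ (by omega)
      have hc : B γ δ = -1 := by
        have := hB.self_add γ δ
        rw [hsum, hβ.1, hγ.1, hδ.1] at this
        omega
      have himg : Module.reflection hγ.1 δ = β := by
        rw [Module.reflection_apply, hc, ← hsum]; simp [add_comm]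
      have hconj := LinearEquiv.conj_reflection (hB.reflection_isometry hγ.1) hδ.1 hβ.1 himg
      refine ⟨l₁ ++ l₂ ++ l₁, ?_⟩
      have : simpleWord B v (l₁ ++ l₂ ++ l₁)
          = simpleWord B v l₁ * simpleWord B v l₂ * simpleWord B v l₁ := by
        simp [simpleWord, mul_assoc]
      rw [this, e₁, e₂, ← hconj, mul_assoc]
      have : Module.reflection hγ.1 * Module.reflection hγ.1 = 1 := by
        ext x; exact Module.involutive_reflection hγ.1 x
      rw [this, mul_one]

theorem exists_simpleWord_of_mem_weylGroup (hB : IsRootLattice B)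
    (hv : ∀ α, B α α = 2 → B v α ≠ 0) {w : L ≃ₗ[ℤ] L} (hw : w ∈ weylGroup B) :
    ∃ l, simpleWord B v l = w := by
  induction hw using Subgroup.closure_induction with
  | mem w h =>
    obtain ⟨α, hα, rfl⟩ := h
    rcases lt_or_gt_of_ne (hv α hα) with h | h
    · have hα' : B (-α) (-α) = 2 := by simpa using hα
      obtain ⟨l, hl⟩ := hB.exists_simpleWord_eq_reflection (v := v) (B v (-α)).toNat (-α)
        ⟨hα', by simpa using h⟩ (Int.self_le_toNat _)
      refine ⟨l, hl.trans ?_⟩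
      ext x
      simp [Module.reflection_apply]
    · exact hB.exists_simpleWord_eq_reflection (B v α).toNat α ⟨hα, h⟩ (Int.self_le_toNat _)
  | one => exact ⟨[], rfl⟩
  | mul x y _ _ hx hy =>
    obtain ⟨l₁, rfl⟩ := hx
    obtain ⟨l₂, rfl⟩ := hy
    exact ⟨l₁ ++ l₂, by simp [simpleWord]⟩
  | inv x _ hx =>
    obtain ⟨l, rfl⟩ := hx
    refine ⟨l.reverse, ?_⟩
    simp only [simpleWord, List.prod_inv_reverse, List.map_map, List.map_reverse]
    congr 2

/-- Some letter `β` turns the image of `α` from positive to negative. As `s_β` negates only `β`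
among the positive roots, that image was `β`, and conjugation moves `s_α` across the word to cancel
this letter. -/
theorem simpleWord_exchange (hB : IsRootLattice B) (hv : ∀ α, B α α = 2 → B v α ≠ 0)
    {α : L} (hα : IsSimpleRoot B v α) (l : List {α // IsSimpleRoot B v α}) :
    B v (simpleWord B v l α) < 0 →
      ∃ l', l'.length + 1 = l.length ∧
        simpleWord B v l * Module.reflection hα.1.1 = simpleWord B v l' := by
  induction l with
  | nil =>
    intro h
    have := hα.1.2
    simp only [simpleWord, List.map_nil, List.prod_nil, LinearEquiv.coe_one, id_eq] at h
    omega
  | cons β l ih =>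
    intro h
    have hcons : ∀ l, simpleWord B v (β :: l) = Module.reflection β.2.1.1 * simpleWord B v l := by
      intro l
      simp [simpleWord]
    have hroot : B (simpleWord B v l α) (simpleWord B v l α) = 2 := by
      rw [hB.simpleWord_isometry, hα.1.1]
    rcases lt_or_gt_of_ne (hv _ hroot) with hneg | hpos
    · obtain ⟨l', hlen, hl'⟩ := ih hneg
      exact ⟨β :: l', by simp [hlen], by rw [hcons, hcons, mul_assoc, hl']⟩
    · have heq : simpleWord B v l α = β := by
        by_contra hne
        have := hB.reflection_pos hv β.2 ⟨hroot, hpos⟩ hne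
        rw [hcons, LinearEquiv.mul_apply] at h
        omega
      refine ⟨l, by simp, ?_⟩
      rw [hcons, LinearEquiv.conj_reflection (hB.simpleWord_isometry l) hα.1.1 β.2.1.1 heq, mul_assoc]
      have : Module.reflection hα.1.1 * Module.reflection hα.1.1 = 1 := by
        ext x; exact Module.involutive_reflection hα.1.1 x
      rw [this, mul_one]

theorem simpleWord_eq_one (hB : IsRootLattice B) (hv : ∀ α, B α α = 2 → B v α ≠ 0) (n : ℕ) :
    ∀ l : List {α // IsSimpleRoot B v α}, l.length ≤ n → simpleWord B v l v = v →
      simpleWord B v l = 1 := by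
  induction n with
  | zero =>
    intro l hl _
    rw [List.length_eq_zero_iff.mp (Nat.le_zero.mp hl)]
    rfl
  | succ n ih =>
    intro l hl hfix
    rcases List.eq_nil_or_concat l with rfl | ⟨l₀, α, rfl⟩
    · rfl
    · have hprod : simpleWord B v (l₀.concat α)
          = simpleWord B v l₀ * Module.reflection α.2.1.1 := by
        simp [simpleWord]
      -- The whole word fixes `v`, so it keeps `α` positive; its last letter negates `α`, so the
      -- shorter word makes `α` negative and exchange applies.
      have hneg : B v (simpleWord B v l₀ α) < 0 := by
        have h1 := hB.simpleWord_isometry (l₀.concat α) v α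
        have h2 := α.2.1.2
        rw [hfix, hprod, LinearEquiv.mul_apply] at h1
        rw [Module.reflection_apply_self, map_neg, map_neg] at h1
        omega
      obtain ⟨l', hlen, hl'⟩ := hB.simpleWord_exchange hv α.2 l₀ hneg
      rw [hprod, hl'] at hfix ⊢
      rw [List.length_concat] at hl
      exact ih l' (by omega) hfix

/-- The Weyl group acts freely on the vectors that are orthogonal to no root. -/
theorem eq_one_of_mem_weylGroup_of_fixes_regular (hB : IsRootLattice B)
    (hv : ∀ α, B α α = 2 → B v α ≠ 0) {w : L ≃ₗ[ℤ] L} (hw : w ∈ weylGroup B) (hfix : w v = v) :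
    w = 1 := by
  obtain ⟨l, rfl⟩ := hB.exists_simpleWord_of_mem_weylGroup hv hw
  exact hB.simpleWord_eq_one hv _ l le_rfl hfix

end IsRootLattice

end Chamber

/-! ### Fixed regular vectors and `p`-groups -/

namespace IsPseudoRootPair

variable {L H : Type*} [AddCommGroup L] [Module.Free ℤ L] [Module.Finite ℤ L]
  [Group H] [Finite H] {p : ℕ} {B : LinearMap.BilinForm ℤ L} {ρ : H →* (L ≃ₗ[ℤ] L)}

theorem smul_notMem_sharpLattice (hR : IsPseudoRootPair p B ρ) {n : ℤ} (hn : IsCoprime n (p : ℤ))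
    {α : L} (hα : B α α = 2) : n • α ∉ sharpLattice p ρ := by
  intro h
  obtain ⟨a, c, hac⟩ := hn
  refine hR.no_roots α ?_ hα
  have h1 : α = a • (n • α) + c • ((p : ℤ) • α) := by
    rw [smul_smul, smul_smul, ← add_smul, hac, one_smul]
  rw [h1]
  exact add_mem (Submodule.smul_mem _ _ h)
    (Submodule.smul_mem _ _ (Submodule.subset_span (Or.inl ⟨α, rfl⟩)))

/-- No root is orthogonal to all of the `K`-fixed sublattice, since its orbit sum is a nonzero fixed
vector that it pairs with nontrivially. Finitely many nonzero functionals then have a common nonzero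
point. -/
theorem exists_regular_fixed (hR : IsPseudoRootPair p B ρ) (K : Subgroup H)
    (hK : (Nat.card K).Coprime p) :
    ∃ v, (∀ k ∈ K, ρ k v = v) ∧ ∀ α, B α α = 2 → B v α ≠ 0 := by
  classical
  have hB := hR.isRootLattice
  have := Fintype.ofFinite K
  let V : Submodule ℤ L := ⨅ k : K, LinearMap.ker ((ρ k : L →ₗ[ℤ] L) - LinearMap.id)
  have hV : ∀ x, x ∈ V ↔ ∀ k ∈ K, ρ k x = x := by
    intro x
    simp [V, sub_eq_zero]
  obtain ⟨v, hvV, hv⟩ := LinearMap.exists_mem_forall_apply_ne_zero V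
    (hB.finite_setOf_self_eq 2).toFinset (fun α => B α) (by
      intro α hα
      have hα : B α α = 2 := by simpa using hα
      set N := ∑ k : K, ρ k α with hN
      have hfix : ∀ k ∈ K, ρ k N = N := by
        intro k hk
        rw [hN, map_sum]
        simp_rw [← LinearEquiv.mul_apply, ← map_mul]
        exact Fintype.sum_bijective (fun x : K => ⟨k, hk⟩ * x) (Group.mulLeft_bijective _) _ _
          fun x => rfl
      refine ⟨N, (hV N).mpr hfix, fun h0 => ?_⟩
      have hNN : B N N = 0 := by
        have : B N N = ∑ k : K, B N (ρ k α) := by rw [← map_sum]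
        rw [this]
        refine Finset.sum_eq_zero fun k _ => ?_
        rw [hB.symm, ← hfix k k.2, hR.isometry, h0]
      have hN0 := hB.eq_zero_of_self hNN
      refine hR.smul_notMem_sharpLattice (n := -(Nat.card K : ℤ)) ?_ hα ?_
      · rw [IsCoprime.neg_left_iff]
        exact Nat.isCoprime_iff_coprime.mpr hK
      -- A vanishing orbit sum exhibits a multiple of `α` prime to `p` in the sharp lattice.
      · have : -(Nat.card K : ℤ) • α = ∑ k : K, (ρ k α - α) := by
          rw [Finset.sum_sub_distrib, ← hN, hN0]
          simp
        rw [this]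
        exact sum_mem fun k _ => Submodule.subset_span (Or.inr ⟨k, α, rfl⟩))
  refine ⟨v, (hV v).mp hvV, fun α hα => ?_⟩
  rw [hB.symm]
  exact hv α (by simpa using hα)

/-- If `p ^ k` is the `p`-part of the order of `g`, then `g ^ p ^ k` generates a group of order
prime to `p`, which fixes a regular vector. -/
theorem isPGroup_of_forall_fixes_regular (hp : p.Prime) (hR : IsPseudoRootPair p B ρ)
    (K : Subgroup H)
    (hK : ∀ g ∈ K, ∀ v, ρ g v = v → (∀ α, B α α = 2 → B v α ≠ 0) → g = 1) : IsPGroup p K := by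
  rw [isPGroup_iff_pow_pow_eq_one]
  rintro ⟨g, hg⟩
  obtain ⟨k, n, hn, hord⟩ := Nat.exists_eq_pow_mul_and_not_dvd (orderOf_pos g).ne' p hp.ne_one
  refine ⟨k, ?_⟩
  have hcop : (Nat.card (Subgroup.zpowers (g ^ p ^ k))).Coprime p := by
    rw [Nat.card_zpowers, orderOf_pow, hord, Nat.gcd_eq_right (Dvd.intro _ rfl),
      Nat.mul_div_cancel_left _ (pow_pos hp.pos k)]
    exact ((Nat.Prime.coprime_iff_not_dvd hp).mpr hn).symm
  obtain ⟨v, hfix, hv⟩ := hR.exists_regular_fixed _ hcop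
  have := hK (g ^ p ^ k) (pow_mem hg _) v (hfix _ (Subgroup.mem_zpowers _)) hv
  ext
  simpa using this

theorem isPGroup_comap_weylGroup (hp : p.Prime) (hR : IsPseudoRootPair p B ρ) :
    IsPGroup p ((weylGroup B).comap ρ) := by
  refine hR.isPGroup_of_forall_fixes_regular hp _ fun g hg v hfix hv => hR.faithful ?_
  rw [map_one]
  exact hR.isRootLattice.eq_one_of_mem_weylGroup_of_fixes_regular hv hg hfix

end IsPseudoRootPair

/-- In a `p`-root pair on a nonzero lattice the order of the group is divisible by `p`. -/
theorem IsRootPair.exists_orderOf_eq {L H : Type*} [AddCommGroup L] [Module.Free ℤ L]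
    [Module.Finite ℤ L] [Group H] [Finite H] {p : ℕ} {B : LinearMap.BilinForm ℤ L}
    {ρ : H →* (L ≃ₗ[ℤ] L)} (hp : p.Prime) (hR : IsRootPair p B ρ) {α : L} (hα : B α α = 2) :
    ∃ g : H, orderOf g = p := by
  have := Fact.mk hp
  apply exists_prime_orderOf_dvd_card'
  by_contra hdvd
  obtain ⟨v, hfix, hv⟩ := hR.exists_regular_fixed ⊤ (by
    rw [Subgroup.card_top]
    exact ((Nat.Prime.coprime_iff_not_dvd hp).mpr hdvd).symm)
  refine hv α hα ?_
  rw [hR.fixed_eq_zero v fun g => hfix g trivial]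
  simp

/-- If a finite `p`-group acts on a lattice of rank `r` without nonzero fixed vectors, then `p - 1`
divides `r`. -/
theorem IsPGroup.sub_one_dvd_finrank {L G : Type*} [AddCommGroup L] [Module.Free ℤ L]
    [Module.Finite ℤ L] [Group G] [Finite G] {p : ℕ} (hp : p.Prime) (hG : IsPGroup p G)
    (ρ : G →* (L ≃ₗ[ℤ] L)) (hfix : ∀ x, (∀ g, ρ g x = x) → x = 0) :
    p - 1 ∣ Module.finrank ℤ L := by
  classical
  have := Fact.mk hp
  have := Fintype.ofFinite G
  -- Let `n` be a primitive root modulo `p`. If the action on `L / nL`, a set of `n ^ r` elements,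
  -- has 0 as its only fixed point, then `n ^ r ≡ 1` modulo `p`, so `p - 1` divides `r`.
  obtain ⟨a, ha⟩ := IsCyclic.exists_generator (α := (ZMod p)ˣ)
  have horder : orderOf a = p - 1 := by
    rw [orderOf_eq_card_of_forall_mem_zpowers ha, Nat.card_eq_fintype_card, ZMod.card_units]
  set n : ℕ := (a : ZMod p).val with hn
  have hna : (n : ZMod p) = a := ZMod.natCast_zmod_val _
  have hcop : n.Coprime p := ZMod.val_coe_unit_coprime a
  obtain ⟨k, hk⟩ := IsPGroup.iff_card.mp hG
  set N : AddSubgroup L := (nsmulAddMonoidHom (α := L) n).range with hN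
  have hmem : ∀ x, x ∈ N ↔ ∃ y, n • y = x := fun x => Iff.rfl
  have hstable : ∀ g, N ≤ N.comap (ρ g : L →+ L) := by
    rintro g _ ⟨y, rfl⟩
    exact ⟨ρ g y, by simp⟩
  have hcard : Nat.card (L ⧸ N) = n ^ Module.finrank ℤ L := AddSubgroup.index_range_nsmul L n
  have hn0 : n ≠ 0 := by
    intro h0
    rw [h0, Nat.coprime_zero_left] at hcop
    exact hp.ne_one hcop
  have : Finite (L ⧸ N) := Nat.finite_of_card_ne_zero (hcard ▸ pow_ne_zero _ hn0)
  let _ : MulAction G (L ⧸ N) :=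
    { smul := fun g => QuotientAddGroup.map N N (ρ g : L →+ L) (hstable g)
      one_smul := by
        rintro ⟨x⟩
        change QuotientAddGroup.mk (ρ 1 x) = _
        rw [map_one]
        rfl
      mul_smul := by
        rintro g h ⟨x⟩
        change QuotientAddGroup.mk (ρ (g * h) x) = QuotientAddGroup.mk (ρ g (ρ h x))
        rw [map_mul]
        rfl }
  have hone : MulAction.fixedPoints G (L ⧸ N) = {0} := by
    ext q
    rw [Set.mem_singleton_iff]
    constructor
    · induction q using QuotientAddGroup.induction_on with | _ x => ?_
      intro hx
      -- Averaging: the orbit sum of `x` is fixed, hence zero, so a fixed class is killed by `|G|`,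
      -- which is prime to `n`.
      have hx' : ∀ g, ρ g x - x ∈ N := fun g => by
        have h : (QuotientAddGroup.mk (ρ g x) : L ⧸ N) = QuotientAddGroup.mk x := hx g
        rw [QuotientAddGroup.eq] at h
        have := N.neg_mem h
        simpa [sub_eq_add_neg, add_comm] using this
      have hsum : ∑ g, ρ g x = 0 := by
        refine hfix _ fun h => ?_
        rw [map_sum]
        simp_rw [← LinearEquiv.mul_apply, ← map_mul]
        exact Fintype.sum_bijective (fun g => h * g) (Group.mulLeft_bijective _) _ _ fun g => rfl
      have h1 : (Nat.card G) • x ∈ N := by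
        have h2 : (Nat.card G) • x = -∑ g, (ρ g x - x) := by
          rw [Finset.sum_sub_distrib, hsum]
          simp [Nat.card_eq_fintype_card]
        rw [h2]
        exact N.neg_mem (sum_mem fun g _ => hx' g)
      obtain ⟨c, d, hcd⟩ : IsCoprime ((Nat.card G : ℕ) : ℤ) (n : ℤ) := by
        rw [Nat.isCoprime_iff_coprime, hk]
        exact (Nat.Coprime.pow_right k hcop).symm
      rw [QuotientAddGroup.eq_zero_iff]
      have h3 : x = c • ((Nat.card G) • x) + d • (n • x) := by
        rw [← natCast_zsmul x n, ← natCast_zsmul x (Nat.card G), smul_smul, smul_smul, ← add_smul,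
          hcd, one_smul]
      rw [h3]
      exact N.add_mem (N.zsmul_mem h1 _) (N.zsmul_mem ⟨x, rfl⟩ _)
    · rintro rfl g
      change QuotientAddGroup.map N N _ _ 0 = 0
      exact map_zero _
  have hmod := hG.card_modEq_card_fixedPoints (L ⧸ N)
  rw [hone, hcard, Nat.card_unique, ← ZMod.natCast_eq_natCast_iff] at hmod
  rw [← horder, orderOf_dvd_iff_pow_eq_one]
  ext
  simpa [hna] using hmod

/-! ### Bases of simple roots and rigidity of Dynkin diagrams -/

section Base

variable {L ι : Type*} [AddCommGroup L] [Module.Free ℤ L] [Module.Finite ℤ L]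
  {B : LinearMap.BilinForm ℤ L} [Fintype ι]

namespace IsRootLattice

/-- If the off-diagonal entries of the Gram matrix of a basis are nonpositive, then the coordinates
of a root do not have opposite signs. -/
theorem repr_nonneg_or_nonpos (hB : IsRootLattice B) (b : Module.Basis ι ℤ L)
    (hb : ∀ i j, i ≠ j → B (b i) (b j) ≤ 0) {α : L} (hα : B α α = 2) :
    (∀ i, 0 ≤ b.repr α i) ∨ ∀ i, b.repr α i ≤ 0 := by
  classical
  set c := b.repr α with hc
  -- Split `α = x - y` into positive and negative parts. As `B x y ≤ 0`, both being nonzero would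
  -- give norm at least 4.
  set x := ∑ i, max (c i) 0 • b i with hx
  set y := ∑ i, max (-c i) 0 • b i with hy
  have hrx : ∀ i, b.repr x i = max (c i) 0 := fun i => by
    rw [hx, b.repr_sum_self]
  have hry : ∀ i, b.repr y i = max (-c i) 0 := fun i => by
    rw [hy, b.repr_sum_self]
  have hxy : α = x - y := by
    apply b.ext_elem
    intro i
    rw [map_sub, Finsupp.sub_apply, hrx, hry, ← hc]
    rcases le_total (c i) 0 with h | h
    · rw [max_eq_right h, max_eq_left (by omega)]; ring
    · rw [max_eq_left h, max_eq_right (by omega)]; ring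
  have hBxy : B x y ≤ 0 := by
    rw [hx, hy]
    simp only [map_sum, map_smul, LinearMap.sum_apply, LinearMap.smul_apply, smul_eq_mul]
    simp only [Finset.mul_sum]
    refine Finset.sum_nonpos fun i _ => Finset.sum_nonpos fun j _ => ?_
    by_cases hij : j = i
    · subst hij
      rcases le_total (c j) 0 with h | h
      · rw [max_eq_right h]; simp
      · rw [max_eq_right (a := -c j) (by omega)]; simp
    · exact mul_nonpos_of_nonneg_of_nonpos (le_max_right _ _)
        (mul_nonpos_of_nonneg_of_nonpos (le_max_right _ _) (hb _ _ hij))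
  have h2 := hB.self_sub x y
  rw [← hxy, hα] at h2
  by_cases hx0 : x = 0
  · right
    intro i
    have := hrx i
    rw [hx0, map_zero, Finsupp.zero_apply] at this
    omega
  by_cases hy0 : y = 0
  · left
    intro i
    have := hry i
    rw [hy0, map_zero, Finsupp.zero_apply] at this
    omega
  have := hB.two_le_self hx0
  have := hB.two_le_self hy0
  omega

/-- Every vector that is orthogonal to no root is moved by the Weyl group into the fundamental
chamber of the given base. -/
theorem exists_mem_weylGroup_dominant (hB : IsRootLattice B) (b : Module.Basis ι ℤ L)
    (hb2 : ∀ i, B (b i) (b i) = 2) {v : L} (hv : ∀ α, B α α = 2 → B v α ≠ 0) :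
    ∃ w ∈ weylGroup B, ∀ i, 0 < B (w v) (b i) := by
  classical
  set S : Set L := {x | ∃ w ∈ weylGroup B, w v = x} with hS
  have hfin : S.Finite := (hB.finite_setOf_self_eq (B v v)).subset (by
    rintro _ ⟨w, hw, rfl⟩
    exact hB.isometry_of_mem_weylGroup hw v v)
  -- Take the point of the finite orbit with largest coordinate sum; the `i`-th reflection lowers
  -- that sum by `B (b i) (w v)`, which is therefore nonnegative, and nonzero by regularity.
  obtain ⟨_, ⟨w, hw, rfl⟩, hmax⟩ :=
    Set.exists_max_image S (fun x => ∑ i, b.repr x i) hfin ⟨v, 1, one_mem _, rfl⟩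
  refine ⟨w, hw, fun i => ?_⟩
  have hle := hmax (Module.reflection (hb2 i) (w v))
    ⟨Module.reflection (hb2 i) * w,
      mul_mem (Subgroup.subset_closure ⟨b i, hb2 i, rfl⟩) hw, rfl⟩
  have h1 : ∑ j, b.repr (Module.reflection (hb2 i) (w v)) j
      = ∑ j, b.repr (w v) j - B (b i) (w v) := by
    simp [Module.reflection_apply, Finset.sum_sub_distrib, Finsupp.single_apply]
  rw [h1] at hle
  have h2 : B (w v) (b i) ≠ 0 := by
    have hinv := hB.isometry_of_mem_weylGroup hw v (w⁻¹ (b i))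
    have hwi : w (w⁻¹ (b i)) = b i := by
      rw [← LinearEquiv.mul_apply, mul_inv_cancel]; rfl
    rw [hwi] at hinv
    rw [hinv]
    apply hv
    rw [hB.isometry_of_mem_weylGroup (inv_mem hw), hb2]
  rw [hB.symm] at hle
  omega

/-- An isometry fixing a vector of the open fundamental chamber permutes the base. -/
theorem exists_apply_eq_of_fixes_dominant (hB : IsRootLattice B) (b : Module.Basis ι ℤ L)
    (hb2 : ∀ i, B (b i) (b i) = 2) (hb : ∀ i j, i ≠ j → B (b i) (b j) ≤ 0)
    {u : L} (hu : ∀ i, 0 < B u (b i)) {h : L ≃ₗ[ℤ] L} (hh : ∀ x y, B (h x) (h y) = B x y)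
    (hfix : h u = u) (i : ι) : ∃ j, h (b i) = b j := by
  classical
  have key : ∀ h : L ≃ₗ[ℤ] L, (∀ x y, B (h x) (h y) = B x y) → h u = u →
      ∀ i, (∀ j, 0 ≤ b.repr (h (b i)) j) ∧ 1 ≤ ∑ j, b.repr (h (b i)) j := by
    intro h hh hfix i
    have hroot : B (h (b i)) (h (b i)) = 2 := by rw [hh, hb2]
    have hpos : 0 < B u (h (b i)) := by rw [← hfix, hh]; exact hu i
    have hsum : B u (h (b i)) = ∑ j, b.repr (h (b i)) j * B u (b j) := by
      conv_lhs => rw [← b.sum_repr (h (b i))]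
      simp only [map_sum, map_smul, smul_eq_mul]
    have hnn : ∀ j, 0 ≤ b.repr (h (b i)) j := by
      refine (hB.repr_nonneg_or_nonpos b hb hroot).resolve_right fun hneg => ?_
      rw [hsum] at hpos
      exact hpos.not_ge (Finset.sum_nonpos fun j _ =>
        mul_nonpos_of_nonpos_of_nonneg (hneg j) (hu j).le)
    refine ⟨hnn, ?_⟩
    by_contra hlt
    have h0 : ∑ j, b.repr (h (b i)) j = 0 :=
      le_antisymm (by omega) (Finset.sum_nonneg fun j _ => hnn j)
    rw [Finset.sum_eq_zero_iff_of_nonneg fun j _ => hnn j] at h0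
    rw [hsum, Finset.sum_eq_zero fun j hj => by rw [h0 j hj, zero_mul]] at hpos
    exact hpos.false
  obtain ⟨hnn, hone⟩ := key h hh hfix i
  have hinv := key h⁻¹ (fun x y => by
    rw [← hh, ← LinearEquiv.mul_apply, ← LinearEquiv.mul_apply, mul_inv_cancel]; rfl)
    (by conv_lhs => rw [← hfix]
        rw [← LinearEquiv.mul_apply, inv_mul_cancel]; rfl)
  -- Compare coordinate sums in `b i = h⁻¹ (h (b i))`. The inner sums are at least 1, so the
  -- nonnegative coefficients of `h (b i)` sum to 1.
  have hexp : ∑ j, b.repr (h (b i)) j * ∑ k, b.repr (h⁻¹ (b j)) k = 1 := by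
    have h1 : b i = ∑ j, b.repr (h (b i)) j • h⁻¹ (b j) := by
      conv_lhs => rw [show b i = h⁻¹ (h (b i)) by
        rw [← LinearEquiv.mul_apply, inv_mul_cancel]; rfl, ← b.sum_repr (h (b i))]
      simp only [map_sum, map_smul]
    have h2 : ∑ k, b.repr (b i) k = 1 := by
      simp [Finsupp.single_apply]
    rw [← h2]
    conv_rhs => rw [h1]
    simp only [map_sum, map_smul, Finsupp.coe_finsetSum, Finset.sum_apply, Finsupp.smul_apply,
      smul_eq_mul, Finset.mul_sum]
    exact Finset.sum_comm
  have hle : ∑ j, b.repr (h (b i)) j ≤ 1 := by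
    rw [← hexp]
    exact Finset.sum_le_sum fun j _ => le_mul_of_one_le_right (hnn j) (hinv j).2
  have hsum1 : ∑ j, b.repr (h (b i)) j = 1 := le_antisymm hle hone
  obtain ⟨j, hj⟩ : ∃ j, 0 < b.repr (h (b i)) j := by
    by_contra! hno
    have := Finset.sum_nonpos fun j (_ : j ∈ Finset.univ) => hno j
    omega
  refine ⟨j, b.ext_elem fun k => ?_⟩
  have hrest : ∑ k ∈ Finset.univ.erase j, b.repr (h (b i)) k ≥ 0 :=
    Finset.sum_nonneg fun k _ => hnn k
  have hsplit := Finset.add_sum_erase Finset.univ (fun k => b.repr (h (b i)) k) (Finset.mem_univ j)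
  simp only [hsum1] at hsplit
  rw [b.repr_self, Finsupp.single_apply]
  split_ifs with hjk
  · subst hjk; omega
  · have hz : ∑ k ∈ Finset.univ.erase j, b.repr (h (b i)) k = 0 := by omega
    rw [Finset.sum_eq_zero_iff_of_nonneg fun k _ => hnn k] at hz
    exact hz k (Finset.mem_erase.mpr ⟨Ne.symm hjk, Finset.mem_univ k⟩)

/-- If the Dynkin diagram of a base has no symmetries, an isometry that fixes a vector orthogonal
to no root is trivial. -/
theorem eq_one_of_fixes_regular_of_rigid (hB : IsRootLattice B) (b : Module.Basis ι ℤ L)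
    (hb2 : ∀ i, B (b i) (b i) = 2) (hb : ∀ i j, i ≠ j → B (b i) (b j) ≤ 0)
    (hrigid : ∀ σ : Equiv.Perm ι, (∀ i j, B (b (σ i)) (b (σ j)) = B (b i) (b j)) → σ = 1)
    {h : L ≃ₗ[ℤ] L} (hh : ∀ x y, B (h x) (h y) = B x y) {v : L}
    (hv : ∀ α, B α α = 2 → B v α ≠ 0) (hfix : h v = v) : h = 1 := by
  obtain ⟨w, hw, hdom⟩ := hB.exists_mem_weylGroup_dominant b hb2 hv
  have hwi := hB.isometry_of_mem_weylGroup hw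
  have hwi' := hB.isometry_of_mem_weylGroup (inv_mem hw)
  -- Conjugating by `w` puts the fixed vector in the open chamber, where the isometry becomes a
  -- diagram symmetry.
  set h' := w * h * w⁻¹ with hh'
  have hiso : ∀ x y, B (h' x) (h' y) = B x y := by
    intro x y
    rw [hh']
    simp only [LinearEquiv.mul_apply]
    rw [hwi, hh, hwi']
  have hfix' : h' (w v) = w v := by
    rw [← LinearEquiv.mul_apply, hh', inv_mul_cancel_right, LinearEquiv.mul_apply, hfix]
  choose σ hσ using hB.exists_apply_eq_of_fixes_dominant b hb2 hb hdom hiso hfix'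
  have hinj : Function.Injective σ := fun i j hij =>
    b.injective (h'.injective (by rw [hσ, hσ, hij]))
  have hσ1 := hrigid (Equiv.ofBijective σ (Finite.injective_iff_bijective.mp hinj)) fun i j => by
    simp only [Equiv.ofBijective_apply]
    rw [← hσ, ← hσ, hiso]
  have hone : h' = 1 := by
    apply b.ext'
    intro i
    rw [hσ]
    exact congrArg b (Equiv.ext_iff.mp hσ1 i)
  have : h = w⁻¹ * h' * w := by rw [hh']; group
  rw [this, hone, mul_one, inv_mul_cancel]

end IsRootLattice

end Base

namespace CartanMatrix

/-- Iterating `C` on the all-ones vector gives vectors invariant under every symmetry of `C`; once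
the entries are distinct, a symmetry must be trivial. This makes rigidity a finite computation. -/
theorem perm_eq_one_of_injective_iterate {ι : Type*} [Fintype ι] (C : Matrix ι ι ℤ) (k : ℕ)
    (hinj : Function.Injective ((fun y => C.mulVec y)^[k] 1)) (σ : Equiv.Perm ι)
    (hσ : ∀ i j, C (σ i) (σ j) = C i j) : σ = 1 := by
  have key : ∀ k i, (fun y => C.mulVec y)^[k] (1 : ι → ℤ) (σ i)
      = (fun y => C.mulVec y)^[k] 1 i := by
    intro k
    induction k with
    | zero => intro i; rfl
    | succ k ih =>
      intro i
      rw [Function.iterate_succ_apply', Matrix.mulVec, Matrix.mulVec, dotProduct, dotProduct,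
        ← Equiv.sum_comp σ]
      exact Finset.sum_congr rfl fun j _ => by rw [hσ, ih]
  ext i
  exact hinj (key k i)

end CartanMatrix

/-! ### The norm map of a finite group -/

section NormKernel

variable {L G : Type*} [AddCommGroup L] [Group G]

/-- The restriction of a representation to an invariant sublattice. -/
def restrictRep (ρ : G →* (L ≃ₗ[ℤ] L)) (M : Submodule ℤ L) (hM : ∀ g, ∀ x ∈ M, ρ g x ∈ M) :
    G →* (M ≃ₗ[ℤ] M) where
  toFun g := LinearEquiv.ofLinearMap ((ρ g : L →ₗ[ℤ] L).restrict (hM g))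
    ((ρ g⁻¹ : L →ₗ[ℤ] L).restrict (hM g⁻¹))
    (by ext x; simp) (by ext x; simp)
  map_one' := by ext x; simp
  map_mul' g h := by ext x; simp

@[simp]
theorem coe_restrictRep_apply (ρ : G →* (L ≃ₗ[ℤ] L)) (M : Submodule ℤ L)
    (hM : ∀ g, ∀ x ∈ M, ρ g x ∈ M) (g : G) (x : M) : (restrictRep ρ M hM g x : L) = ρ g x := rfl

/-- The sum of all operators of a finite group acting on a lattice. -/
def normMap [Fintype G] (ρ : G →* (L ≃ₗ[ℤ] L)) : L →ₗ[ℤ] L := ∑ g, (ρ g : L →ₗ[ℤ] L)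

variable [Fintype G] (ρ : G →* (L ≃ₗ[ℤ] L))

theorem normMap_apply (x : L) : normMap ρ x = ∑ g, ρ g x := by
  simp [normMap]

theorem normMap_map (h : G) (x : L) : normMap ρ (ρ h x) = normMap ρ x := by
  rw [normMap_apply, normMap_apply]
  simp_rw [← LinearEquiv.mul_apply, ← map_mul]
  exact Fintype.sum_bijective (fun g => g * h) (Group.mulRight_bijective _) _ _ fun g => rfl

theorem map_normMap (h : G) (x : L) : ρ h (normMap ρ x) = normMap ρ x := by
  rw [normMap_apply, map_sum]
  simp_rw [← LinearEquiv.mul_apply, ← map_mul]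
  exact Fintype.sum_bijective (fun g => h * g) (Group.mulLeft_bijective _) _ _ fun g => rfl

theorem normMap_of_fixed {x : L} (hx : ∀ g, ρ g x = x) : normMap ρ x = Fintype.card G • x := by
  simp [normMap_apply, hx]

theorem IsPGroup.sub_one_dvd_finrank_ker_normMap [Module.Free ℤ L] [Module.Finite ℤ L] {p : ℕ}
    (hp : p.Prime) (hG : IsPGroup p G) :
    p - 1 ∣ Module.finrank ℤ (LinearMap.ker (normMap ρ)) := by
  have hM : ∀ g, ∀ x ∈ LinearMap.ker (normMap ρ), ρ g x ∈ LinearMap.ker (normMap ρ) := by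
    intro g x hx
    rw [LinearMap.mem_ker] at hx ⊢
    rw [normMap_map, hx]
  refine hG.sub_one_dvd_finrank hp (restrictRep ρ _ hM) fun x hx => ?_
  have hx' : ∀ g, ρ g (x : L) = x := fun g => by
    rw [← coe_restrictRep_apply ρ _ hM, hx]
  have h0 : normMap ρ (x : L) = 0 := x.2
  rw [normMap_of_fixed ρ hx', ← natCast_zsmul, smul_eq_zero] at h0
  ext
  simpa [Fintype.card_ne_zero] using h0

/-- A `p`-group acting nontrivially on a lattice of rank at most `p - 1` has norm map zero. -/
theorem IsPGroup.normMap_eq_zero [Module.Free ℤ L] [Module.Finite ℤ L] {p : ℕ}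
    (hp : p.Prime) (hG : IsPGroup p G) (hrank : Module.finrank ℤ L ≤ p - 1) {g : G}
    (hg : ρ g ≠ 1) : normMap ρ = 0 := by
  have hdvd := hG.sub_one_dvd_finrank_ker_normMap ρ hp
  have hadd := (LinearMap.ker (normMap ρ)).finrank_quotient_add_finrank
  rw [(normMap ρ).quotKerEquivRange.finrank_eq] at hadd
  -- The kernel contains all `ρ g x - x`, so it is nonzero. Its rank is then at least `p - 1`,
  -- leaving rank 0 for the image.
  have hpos : Module.finrank ℤ (LinearMap.ker (normMap ρ)) ≠ 0 := by
    intro h0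
    apply hg
    rw [Submodule.finrank_eq_zero] at h0
    ext x
    have hx : ρ g x - x ∈ LinearMap.ker (normMap ρ) := by
      rw [LinearMap.mem_ker, map_sub, normMap_map, sub_self]
    rw [h0, Submodule.mem_bot, sub_eq_zero] at hx
    exact hx
  have hle := Nat.le_of_dvd (Nat.pos_of_ne_zero hpos) hdvd
  have h0 : Module.finrank ℤ (LinearMap.range (normMap ρ)) = 0 := by omega
  rw [Submodule.finrank_eq_zero] at h0
  exact LinearMap.range_eq_bot.mp h0

end NormKernel

/-! ### Exceptional types -/

section Exceptional

/-- The radical of the `E₆` lattice modulo `3` is one-dimensional. -/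
theorem HasType.exists_radical_E₆ {L : Type*} [AddCommGroup L]
    {B : LinearMap.BilinForm ℤ L} (hE : HasType B CartanMatrix.E₆) :
    ∃ r : L, (∀ y, (3 : ℤ) ∣ B r y) ∧ (∀ (k : ℤ) y, k • r = (3 : ℤ) • y → 3 ∣ k) ∧
      ∀ x, (∀ y, (3 : ℤ) ∣ B x y) → ∃ (k : ℤ) (y : L), x = k • r + (3 : ℤ) • y := by
  obtain ⟨b, hb⟩ := hE
  have hrow : ∀ x j, B x (b j) = ∑ i, b.repr x i * CartanMatrix.E₆ i j := by
    intro x j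
    conv_lhs => rw [← b.sum_repr x]
    simp only [map_sum, map_smul, LinearMap.sum_apply, LinearMap.smul_apply, smul_eq_mul, hb]
  -- This vector spans the kernel of the Cartan matrix modulo 3.
  refine ⟨b 0 - b 2 + b 4 - b 5, ?_, ?_, ?_⟩
  · intro y
    rw [← b.sum_repr y, map_sum]
    refine Finset.dvd_sum fun j _ => ?_
    rw [map_smul, smul_eq_mul]
    refine Dvd.dvd.mul_left ?_ _
    simp only [map_sub, map_add, LinearMap.sub_apply, LinearMap.add_apply, hb]
    revert j
    decide
  · intro k y h
    have h0 := congrArg (fun z => b.repr z 0) h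
    simp at h0
    exact ⟨_, h0⟩
  · intro x hx
    have h (j) : (3 : ℤ) ∣ ∑ i, b.repr x i * CartanMatrix.E₆ i j := hrow x j ▸ hx (b j)
    set c := b.repr x with hc
    have h0 := h 0
    have h1 := h 1
    have h2 := h 2
    have h3 := h 3
    have h4 := h 4
    have h5 := h 5
    simp [Fin.sum_univ_succ, CartanMatrix.E₆] at h0 h1 h2 h3 h4 h5
    have hdvd : ∀ i, (3 : ℤ) ∣ c i - c 0 * b.repr (b 0 - b 2 + b 4 - b 5) i := by
      intro i
      fin_cases i <;> simp <;> omega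
    choose d hd using hdvd
    refine ⟨c 0, ∑ i, d i • b i, b.ext_elem fun i => ?_⟩
    rw [map_add, map_smul, map_smul, Finsupp.add_apply, Finsupp.smul_apply, Finsupp.smul_apply,
      b.repr_sum_self, smul_eq_mul, smul_eq_mul, ← hd]
    ring

variable {L H : Type*} [AddCommGroup L] [Module.Free ℤ L] [Module.Finite ℤ L]
  [Group H] [Finite H] {p : ℕ} {B : LinearMap.BilinForm ℤ L} {ρ : H →* (L ≃ₗ[ℤ] L)}

theorem IsRootPair.not_hasType_E₆ (hp : p.Prime) (hp7 : 7 ≤ p) (hR : IsRootPair p B ρ) :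
    ¬ HasType B CartanMatrix.E₆ := by
  intro hE
  have := Fact.mk hp
  obtain ⟨r, hr, hr3, hrad⟩ := hE.exists_radical_E₆
  obtain ⟨b, hb⟩ := hE
  obtain ⟨g, hg⟩ := hR.exists_orderOf_eq hp (α := b 0) (by rw [hb]; decide)
  let K := Subgroup.zpowers g
  have := Fintype.ofFinite K
  have hcard : Nat.card K = p := by rw [Nat.card_zpowers, hg]
  have hzero := (IsPGroup.of_card (p := p) (n := 1) (G := K) (by rw [hcard, pow_one])).normMap_eq_zero
    (ρ.comp K.subtype) hp (by rw [Module.finrank_eq_card_basis b, Fintype.card_fin]; omega)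
    (g := ⟨g, Subgroup.mem_zpowers g⟩) (by
      intro h1
      have : g = 1 := hR.faithful (by rw [map_one]; exact h1)
      rw [this, orderOf_one] at hg
      exact hp.one_lt.ne hg)
  have hfix : ∀ z : K, ∃ (y : L), ρ z r = r + (3 : ℤ) • y := by
    intro z
    have hodd : Odd p := hp.odd_of_ne_two (by omega)
    obtain ⟨m, hm⟩ := hodd
    -- Since `z ^ p = 1` with `p = 2 m + 1`, `z = t * t`. The isometry `t` acts on the radical line
    -- by a unit modulo 3, whose square is 1, so `z` fixes `r` modulo 3.
    set t : H := (z : H) ^ (m + 1) with ht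
    have hz : (z : H) = t * t := by
      rw [ht, ← pow_add, show m + 1 + (m + 1) = p + 1 by omega, pow_succ]
      have : (z : H) ^ p = 1 := by
        have := pow_card_eq_one' (x := z)
        rw [hcard] at this
        exact_mod_cast congrArg Subtype.val this
      rw [this, one_mul]
    obtain ⟨k, y, hk⟩ := hrad (ρ t r) fun y => by
      have hy : y = ρ t (ρ t⁻¹ y) := by
        rw [← LinearEquiv.mul_apply, ← map_mul, mul_inv_cancel, map_one]; rfl
      rw [hy, hR.isometry]
      exact hr _
    have hk3 : ¬ (3 : ℤ) ∣ k := by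
      rintro ⟨l, rfl⟩
      have h1 : (1 : ℤ) • r = (3 : ℤ) • ρ t⁻¹ (l • r + y) := by
        rw [← map_smul, smul_add, smul_smul, ← hk, ← LinearEquiv.mul_apply, ← map_mul,
          inv_mul_cancel, map_one, one_smul]
        rfl
      have := hr3 1 _ h1
      omega
    have hk2 : ∃ l, k * k = 1 + 3 * l := by
      have : k % 3 = 1 ∨ k % 3 = 2 := by omega
      rcases this with h | h
      · refine ⟨(k * k - 1) / 3, ?_⟩
        have : (k * k) % 3 = 1 := by rw [Int.mul_emod, h]; rfl
        omega
      · refine ⟨(k * k - 1) / 3, ?_⟩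
        have : (k * k) % 3 = 1 := by rw [Int.mul_emod, h]; rfl
        omega
    obtain ⟨l, hl⟩ := hk2
    refine ⟨l • r + k • y + ρ t y, ?_⟩
    rw [hz, map_mul, LinearEquiv.mul_apply, hk, map_add, map_smul, map_smul, hk, smul_add,
      smul_smul, hl]
    module
  choose y hy using hfix
  -- The norm of `r` is both zero and congruent to `p • r` modulo 3, which forces 3 to divide `p`.
  have hN : (p : ℤ) • r = (3 : ℤ) • (-∑ z, y z) := by
    have h0 : normMap (ρ.comp K.subtype) r = 0 := by rw [hzero]; rfl
    rw [normMap_apply] at h0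
    simp only [MonoidHom.comp_apply, Subgroup.coe_subtype, hy, Finset.sum_add_distrib,
      Finset.sum_const, Finset.card_univ, ← Nat.card_eq_fintype_card, hcard,
      ← Finset.smul_sum] at h0
    rw [natCast_zsmul, smul_neg]
    exact eq_neg_of_add_eq_zero_left h0
  have h3 := hr3 _ _ hN
  have h3' : 3 ∣ p := by exact_mod_cast h3
  have := (Nat.prime_dvd_prime_iff_eq Nat.prime_three hp).mp h3'
  omega

/-- If the Dynkin diagram of the lattice has no symmetries, then `p - 1` divides its rank. -/
theorem IsRootPair.sub_one_dvd_of_rigid {ι : Type*} [Fintype ι] (hp : p.Prime)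
    (hR : IsRootPair p B ρ) {C : Matrix ι ι ℤ} (hC : HasType B C) (hdiag : ∀ i, C i i = 2)
    (hoff : ∀ i j, i ≠ j → C i j ≤ 0)
    (hrigid : ∀ σ : Equiv.Perm ι, (∀ i j, C (σ i) (σ j) = C i j) → σ = 1) :
    p - 1 ∣ Fintype.card ι := by
  obtain ⟨b, hb⟩ := hC
  have hP : IsPGroup p (⊤ : Subgroup H) :=
    hR.isPGroup_of_forall_fixes_regular hp ⊤ fun g _ v hfix hv => hR.faithful (by
      rw [map_one]
      exact hR.isRootLattice.eq_one_of_fixes_regular_of_rigid b (fun i => by rw [hb, hdiag])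
        (fun i j hij => by rw [hb]; exact hoff i j hij)
        (fun σ hσ => hrigid σ fun i j => by rw [← hb, ← hb, hσ]) (hR.isometry g) hv hfix)
  rw [← Module.finrank_eq_card_basis b]
  exact hP.sub_one_dvd_finrank hp (ρ.comp (⊤ : Subgroup H).subtype) fun x hx =>
    hR.fixed_eq_zero x fun g => hx ⟨g, trivial⟩

/-- In the rigid cases `p - 1` divides 7 or 8, and `p ≥ 7` leaves only the composite values 8 and 9.
-/
theorem IsRootPair.not_hasTypeE (hp : p.Prime) (hp7 : 7 ≤ p) (hR : IsRootPair p B ρ) :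
    ¬ HasTypeE B := by
  rintro (h | h | h)
  · exact hR.not_hasType_E₆ hp hp7 h
  · have hdvd := hR.sub_one_dvd_of_rigid hp h CartanMatrix.E₇_diag CartanMatrix.E₇_off_diag_nonpos
      (CartanMatrix.perm_eq_one_of_injective_iterate _ 3 (by decide))
    rw [Fintype.card_fin] at hdvd
    have := Nat.le_of_dvd (by norm_num) hdvd
    have : p = 7 ∨ p = 8 := by omega
    rcases this with rfl | rfl
    · omega
    · norm_num at hp
  · have hdvd := hR.sub_one_dvd_of_rigid hp h CartanMatrix.E₈_diag CartanMatrix.E₈_off_diag_nonpos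
      (CartanMatrix.perm_eq_one_of_injective_iterate _ 4 (by decide))
    rw [Fintype.card_fin] at hdvd
    have := Nat.le_of_dvd (by norm_num) hdvd
    have : p = 7 ∨ p = 8 ∨ p = 9 := by omega
    rcases this with rfl | rfl | rfl
    · omega
    · omega
    · norm_num at hp

end Exceptional

/-! ### Restriction to orthogonal summands -/

section Summand

variable {L H : Type*} [AddCommGroup L] [Group H] {p : ℕ}
  {B : LinearMap.BilinForm ℤ L} {ρ : H →* (L ≃ₗ[ℤ] L)}

/-- The group of automorphisms of a sublattice that are restrictions of elements of `H`. -/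
def inducedGroup (ρ : H →* (L ≃ₗ[ℤ] L)) (M : Submodule ℤ L) : Subgroup (M ≃ₗ[ℤ] M) where
  carrier := {u | ∃ g : H, ∀ x : M, ρ g x = u x}
  one_mem' := ⟨1, fun x => by simp⟩
  mul_mem' := by
    rintro u v ⟨g, hg⟩ ⟨h, hh⟩
    exact ⟨g * h, fun x => by
      rw [map_mul, LinearEquiv.mul_apply, hh, hg, LinearEquiv.mul_apply]⟩
  inv_mem' := by
    rintro u ⟨g, hg⟩
    refine ⟨g⁻¹, fun x => ?_⟩
    have h1 : (x : L) = ρ g (u⁻¹ x : M) := by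
      rw [hg, ← LinearEquiv.mul_apply, mul_inv_cancel]; rfl
    conv_lhs => rw [h1]
    rw [← LinearEquiv.mul_apply, ← map_mul, inv_mul_cancel, map_one]
    rfl

theorem finite_inducedGroup [Finite H] (ρ : H →* (L ≃ₗ[ℤ] L)) (M : Submodule ℤ L) :
    Finite (inducedGroup ρ M) := by
  choose f hf using fun u : inducedGroup ρ M => u.2
  refine Finite.of_injective f fun u v huv => ?_
  ext x
  rw [← hf, ← hf, huv]

/-- An orthogonal summand with connected Dynkin diagram is mapped by every isometry into itself or
into its orthogonal complement. -/
theorem IsRootLattice.map_mem_or_orthogonal {ι : Type*} [Module.Free ℤ L] [Module.Finite ℤ L]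
    (hB : IsRootLattice B) {M : Submodule ℤ L} (hM : IsOrthogonalSummand B M)
    {C : Matrix ι ι ℤ} (hC : HasType (B.restrict M) C) (hdiag : ∀ i, C i i = 2)
    (hconn : ∀ S : ι → Prop, (∀ i j, C i j ≠ 0 → S i → S j) → ∀ i j, S i → S j)
    {h : L ≃ₗ[ℤ] L} (hh : ∀ x y, B (h x) (h y) = B x y) :
    (∀ x ∈ M, h x ∈ M) ∨ ∀ x ∈ M, ∀ y ∈ M, B (h x) y = 0 := by
  obtain ⟨N, htop, horth⟩ := hM
  obtain ⟨b, hb⟩ := hC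
  have hb' : ∀ i j, B (b i : L) (b j) = C i j := hb
  -- A root cannot have two nonzero orthogonal components, since each would have norm at least 2.
  -- Connectedness then puts all images on the same side.
  have hsplit : ∀ i, h (b i) ∈ M ∨ h (b i) ∈ N := by
    intro i
    obtain ⟨y, hy, z, hz, hyz⟩ := Submodule.mem_sup.mp (htop ▸ Submodule.mem_top : h (b i) ∈ M ⊔ N)
    have h2 : B (y + z) (y + z) = 2 := by rw [hyz, hh, hb', hdiag]
    rw [hB.self_add, horth y hy z hz] at h2
    by_cases hy0 : y = 0
    · right; rw [← hyz, hy0, zero_add]; exact hz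
    by_cases hz0 : z = 0
    · left; rw [← hyz, hz0, add_zero]; exact hy
    have := hB.two_le_self hy0
    have := hB.two_le_self hz0
    omega
  have hspan : ∀ (P : Submodule ℤ L), (∀ i, h (b i) ∈ P) → ∀ x ∈ M, h x ∈ P := by
    intro P hP x hx
    have h1 : (⊤ : Submodule ℤ M) ≤ P.comap ((h : L →ₗ[ℤ] L) ∘ₗ M.subtype) := by
      rw [← b.span_eq, Submodule.span_le]
      rintro _ ⟨i, rfl⟩
      exact hP i
    exact h1 (Submodule.mem_top (x := ⟨x, hx⟩))
  by_cases hex : ∃ i, h (b i) ∈ M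
  · left
    obtain ⟨i, hi⟩ := hex
    refine hspan M fun j => hconn (fun i => h (b i) ∈ M) (fun i j hij hi => ?_) i j hi
    refine (hsplit j).resolve_right fun hj => hij ?_
    rw [← hb', ← hh]
    exact horth _ hi _ hj
  · right
    push Not at hex
    intro x hx y hy
    rw [hB.symm]
    exact horth y hy _ (hspan N (fun i => (hsplit i).resolve_left (hex i)) x hx)

/-- The stabilizer of an orthogonal summand with connected Dynkin diagram induces a root pair on
that summand. -/
theorem IsRootPair.restrict [Module.Free ℤ L] [Module.Finite ℤ L] [Finite H] {ι : Type*}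
    (hR : IsRootPair p B ρ) {M : Submodule ℤ L} (hM : IsOrthogonalSummand B M)
    {C : Matrix ι ι ℤ} (hC : HasType (B.restrict M) C) (hdiag : ∀ i, C i i = 2)
    (hconn : ∀ S : ι → Prop, (∀ i j, C i j ≠ 0 → S i → S j) → ∀ i j, S i → S j)
    [Finite (inducedGroup ρ M)] :
    IsRootPair p (B.restrict M) (inducedGroup ρ M).subtype where
  isRootLattice :=
    { symm := fun x y => hR.isRootLattice.symm x y
      posDef := fun x hx => hR.isRootLattice.posDef x (by simpa using hx)
      span_roots := by
        obtain ⟨b, hb⟩ := hC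
        rw [eq_top_iff, ← b.span_eq]
        refine Submodule.span_mono ?_
        rintro _ ⟨i, rfl⟩
        exact (hb i i).trans (hdiag i) }
  isometry := by
    rintro ⟨u, g, hg⟩ x y
    change B (u x : L) (u y) = B x y
    rw [← hg, ← hg, hR.isometry]
  faithful := Subtype.val_injective
  no_roots := by
    intro x hx
    refine hR.no_roots x ?_
    have hle : sharpLattice p (inducedGroup ρ M).subtype ≤ (sharpLattice p ρ).comap M.subtype := by
      refine Submodule.span_le.mpr ?_
      rintro _ (⟨α, rfl⟩ | ⟨⟨u, g, hg⟩, α, rfl⟩)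
      · exact Submodule.subset_span (Or.inl ⟨α, rfl⟩)
      · refine Submodule.subset_span (Or.inr ⟨g, α, ?_⟩)
        rw [hg]
        rfl
    exact hle hx
  fixed_eq_zero := by
    intro x hx
    have := Fintype.ofFinite H
    have hB := hR.isRootLattice
    have hdich (g : H) := hB.map_mem_or_orthogonal hM hC hdiag hconn (hR.isometry g)
    -- Pair the vanishing orbit sum with `x`: elements preserving `M` fix `x` and the others send it
    -- to a vector orthogonal to `M`, so all terms are nonnegative and the term of `1` gives `B x x
    -- = 0`.
    have hN : normMap ρ (x : L) = 0 := hR.fixed_eq_zero _ fun g => map_normMap ρ g _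
    have hnonneg : ∀ g : H, 0 ≤ B (ρ g x) x := by
      intro g
      rcases hdich g with hg | hg
      · have hcancel : ∀ y, ρ g⁻¹ (ρ g y) = y := fun y => by
          rw [← LinearEquiv.mul_apply, ← map_mul, inv_mul_cancel, map_one]; rfl
        have hg' : ∀ y ∈ M, ρ g⁻¹ y ∈ M := by
          rcases hdich g⁻¹ with h | h
          · exact h
          · intro y hy
            have h0 := h (ρ g y) (hg y hy) y hy
            rw [hcancel] at h0
            rw [hB.eq_zero_of_self h0, map_zero]
            exact M.zero_mem
        let u : M ≃ₗ[ℤ] M := LinearEquiv.ofLinearMap ((ρ g : L →ₗ[ℤ] L).restrict hg)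
          ((ρ g⁻¹ : L →ₗ[ℤ] L).restrict hg') (by ext y; simp) (by ext y; simp)
        have hux := hx ⟨u, g, fun y => rfl⟩
        have hgx : ρ g x = x := congrArg Subtype.val hux
        rw [hgx]
        exact hB.self_nonneg _
      · rw [hg x x.2 x x.2]
    have hsum : ∑ g, B (ρ g x) x = 0 := by
      rw [normMap_apply] at hN
      rw [← LinearMap.sum_apply, ← map_sum, hN, map_zero, LinearMap.zero_apply]
    rw [Finset.sum_eq_zero_iff_of_nonneg fun g _ => hnonneg g] at hsum
    have h1 := hsum 1 (Finset.mem_univ _)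
    rw [map_one] at h1
    exact Subtype.ext (hB.eq_zero_of_self h1)

end Summand

namespace CartanMatrix

theorem connected_of_walk {n : ℕ} {C : Matrix (Fin n) (Fin n) ℤ} (parent : Fin n → Fin n)
    (root : Fin n) (hroot : ∀ i, parent^[n] i = root)
    (hadj : ∀ i, C i (parent i) ≠ 0 ∧ C (parent i) i ≠ 0)
    (S : Fin n → Prop) (hS : ∀ i j, C i j ≠ 0 → S i → S j) (i j : Fin n) (hi : S i) : S j := by
  have key : ∀ k i, S i ↔ S (parent^[k] i) := by
    intro k
    induction k with
    | zero => intro i; rfl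
    | succ k ih =>
      intro i
      rw [Function.iterate_succ_apply, ← ih]
      exact ⟨hS _ _ (hadj i).1, hS _ _ (hadj i).2⟩
  rw [key n, hroot] at hi ⊢
  exact hi

/-- The list is the parent map of the Dynkin tree rooted at the branch node 3. The root is its own
parent, which is harmless because diagonal entries are nonzero. -/
theorem E₆_connected (S : Fin 6 → Prop) (hS : ∀ i j, E₆ i j ≠ 0 → S i → S j) (i j : Fin 6) :
    S i → S j :=
  connected_of_walk ![2, 3, 3, 3, 3, 4] 3 (by decide) (by decide) S hS i j

theorem E₇_connected (S : Fin 7 → Prop) (hS : ∀ i j, E₇ i j ≠ 0 → S i → S j) (i j : Fin 7) :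
    S i → S j :=
  connected_of_walk ![2, 3, 3, 3, 3, 4, 5] 3 (by decide) (by decide) S hS i j

theorem E₈_connected (S : Fin 8 → Prop) (hS : ∀ i j, E₈ i j ≠ 0 → S i → S j) (i j : Fin 8) :
    S i → S j :=
  connected_of_walk ![2, 3, 3, 3, 3, 4, 5, 6] 3 (by decide) (by decide) S hS i j

end CartanMatrix

theorem IsRootPair.not_hasTypeE_summand {L H : Type*} [AddCommGroup L] [Module.Free ℤ L]
    [Module.Finite ℤ L] [Group H] [Finite H] {p : ℕ} {B : LinearMap.BilinForm ℤ L}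
    {ρ : H →* (L ≃ₗ[ℤ] L)} (hp : p.Prime) (hp7 : 7 ≤ p) (hR : IsRootPair p B ρ)
    {M : Submodule ℤ L} (hM : IsOrthogonalSummand B M) : ¬ HasTypeE (B.restrict M) := by
  intro hE
  have := finite_inducedGroup ρ M
  have hpair : IsRootPair p (B.restrict M) (inducedGroup ρ M).subtype := by
    rcases hE with h | h | h
    · exact hR.restrict hM h CartanMatrix.E₆_diag CartanMatrix.E₆_connected
    · exact hR.restrict hM h CartanMatrix.E₇_diag CartanMatrix.E₇_connected
    · exact hR.restrict hM h CartanMatrix.E₈_diag CartanMatrix.E₈_connected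
  exact hpair.not_hasTypeE hp hp7 hE

/-! ### Standard coordinates -/

section Coordinates

theorem IsRootLattice.exists_coordinates {L ι κ : Type*} [AddCommGroup L] [Module.Free ℤ L]
    [Module.Finite ℤ L] [Finite ι] [Fintype κ] {B : LinearMap.BilinForm ℤ L}
    (hB : IsRootLattice B) {C : Matrix ι ι ℤ} (hC : HasType B C) (c : ι → κ → ℤ)
    (hc : ∀ i j, c i ⬝ᵥ c j = C i j) :
    ∃ φ : L →ₗ[ℤ] (κ → ℤ), Function.Injective φ ∧ (∀ x y, B x y = φ x ⬝ᵥ φ y) ∧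
      LinearMap.range φ = Submodule.span ℤ (Set.range c) := by
  obtain ⟨b, hb⟩ := hC
  have := Fintype.ofFinite ι
  have hiso : ∀ x y, B x y = b.constr ℤ c x ⬝ᵥ b.constr ℤ c y := by
    intro x y
    have h : B = (dotProductBilin ℤ ℤ).compl₁₂ (b.constr ℤ c) (b.constr ℤ c) :=
      LinearMap.ext_basis b b fun i j => by
        rw [LinearMap.compl₁₂_apply, b.constr_basis, b.constr_basis, hb, ← hc]
        rfl
    rw [h]
    rfl
  refine ⟨b.constr ℤ c, ?_, hiso, b.constr_range ℤ⟩
  rw [injective_iff_map_eq_zero]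
  intro x hx
  exact hB.eq_zero_of_self (by rw [hiso, hx, zero_dotProduct])

theorem exists_eq_single_of_dotProduct_self {κ : Type*} [Fintype κ] [DecidableEq κ] {w : κ → ℤ}
    (h : w ⬝ᵥ w = 1) : ∃ j, w = Pi.single j 1 ∨ w = -Pi.single j 1 := by
  obtain ⟨j, hj⟩ : ∃ j, w j ≠ 0 := by
    by_contra! h0
    have : w = 0 := funext h0
    simp [this] at h
  have hsplit : w j * w j + ∑ k ∈ Finset.univ.erase j, w k * w k = 1 := by
    rw [Finset.add_sum_erase Finset.univ (fun k => w k * w k) (Finset.mem_univ j)]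
    exact h
  have hnn : 0 ≤ ∑ k ∈ Finset.univ.erase j, w k * w k :=
    Finset.sum_nonneg fun k _ => mul_self_nonneg _
  have hpos : 0 < w j * w j := mul_self_pos.mpr hj
  have hj1 : w j * w j = 1 := by omega
  have h0 : ∑ k ∈ Finset.univ.erase j, w k * w k = 0 := by omega
  rw [Finset.sum_eq_zero_iff_of_nonneg fun k _ => mul_self_nonneg _] at h0
  have hk : ∀ k, k ≠ j → w k = 0 := fun k hk =>
    mul_self_eq_zero.mp (h0 k (Finset.mem_erase.mpr ⟨hk, Finset.mem_univ k⟩))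
  refine ⟨j, ?_⟩
  rcases mul_self_eq_one_iff.mp hj1 with h1 | h1
  · left
    ext k
    by_cases hkj : k = j
    · subst hkj; simp [h1]
    · simp [hk k hkj, hkj]
  · right
    ext k
    by_cases hkj : k = j
    · subst hkj; simp [h1]
    · simp [hk k hkj, hkj]

end Coordinates

/-! ### Type `D` -/

section TypeD

/-- The standard simple roots `e_i - e_{i+1}` and `e_{m-2} + e_{m-1}` of type `D_m`. -/
def simpleRootsD (m : ℕ) (hm : 4 ≤ m) (i : Fin m) : Fin m → ℤ :=
  if h : (i : ℕ) + 1 < m then Pi.single i 1 - Pi.single ⟨i + 1, h⟩ 1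
  else Pi.single ⟨m - 2, by omega⟩ 1 + Pi.single ⟨m - 1, by omega⟩ 1

theorem simpleRootsD_dotProduct (m : ℕ) (hm : 4 ≤ m) (i j : Fin m) :
    simpleRootsD m hm i ⬝ᵥ simpleRootsD m hm j = CartanMatrix.D m i j := by
  obtain ⟨i, hi⟩ := i
  obtain ⟨j, hj⟩ := j
  simp only [simpleRootsD, CartanMatrix.D, Matrix.of_apply]
  split_ifs <;>
    simp only [sub_dotProduct, add_dotProduct, single_dotProduct, one_mul, Pi.sub_apply,
      Pi.add_apply, Pi.single_apply, Fin.mk.injEq] at * <;> split_ifs <;> omega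

theorem mem_span_simpleRootsD (m : ℕ) (hm : 4 ≤ m) (z : Fin m → ℤ) :
    z ∈ Submodule.span ℤ (Set.range (simpleRootsD m hm)) ↔ Even (∑ i, z i) := by
  set V := Submodule.span ℤ (Set.range (simpleRootsD m hm)) with hV
  have hmem : ∀ i, simpleRootsD m hm i ∈ V := fun i => Submodule.subset_span ⟨i, rfl⟩
  constructor
  · intro hz
    induction hz using Submodule.span_induction with
    | mem x h =>
      obtain ⟨i, rfl⟩ := h
      rw [simpleRootsD]
      split_ifs <;> simp [Finset.sum_add_distrib]
    | zero => simp
    | add x y _ _ hx hy => simpa [Finset.sum_add_distrib] using hx.add hy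
    | smul a x _ hx =>
      simp only [Pi.smul_apply, smul_eq_mul, ← Finset.mul_sum]
      exact hx.mul_left a
  · rintro ⟨t, ht⟩
    let o : Fin m := ⟨0, by omega⟩
    have hdiff : ∀ k (hk : k < m), (Pi.single ⟨k, hk⟩ 1 - Pi.single o 1 : Fin m → ℤ) ∈ V := by
      intro k
      induction k with
      | zero => intro hk; simp [o]
      | succ k ih =>
        intro hk
        have h1 := V.sub_mem (ih (by omega)) (hmem ⟨k, by omega⟩)
        rw [simpleRootsD, dif_pos hk] at h1
        convert h1 using 1
        abel
    have htwo : (2 : ℤ) • (Pi.single o 1 : Fin m → ℤ) ∈ V := by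
      -- The last simple root is `e_{m-2} + e_{m-1}`; removing `e_{m-2} - e_0` and `e_{m-1} - e_0`
      -- leaves `2 e_0`.
      have h1 := V.sub_mem (V.sub_mem (hmem ⟨m - 1, by omega⟩) (hdiff (m - 2) (by omega)))
        (hdiff (m - 1) (by omega))
      rw [simpleRootsD, dif_neg (by simp only; omega)] at h1
      convert h1 using 1
      module
    have hz : z = ∑ i, z i • (Pi.single i 1 - Pi.single o 1 : Fin m → ℤ)
        + t • ((2 : ℤ) • (Pi.single o 1 : Fin m → ℤ)) := by
      simp only [smul_sub, Finset.sum_sub_distrib, ← Finset.sum_smul, ht, smul_smul]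
      have h1 : ∑ i, z i • (Pi.single i 1 : Fin m → ℤ) = z := by
        rw [← pi_eq_sum_univ' z]
      rw [h1]
      module
    rw [hz]
    exact V.add_mem (sum_mem fun i _ => V.smul_mem _ (hdiff i i.2)) (V.smul_mem _ htwo)

variable {L H : Type*} [AddCommGroup L] [Module.Free ℤ L] [Module.Finite ℤ L]
  [Group H] [Finite H] {p : ℕ} {B : LinearMap.BilinForm ℤ L} {ρ : H →* (L ≃ₗ[ℤ] L)} {m : ℕ}

theorem IsRootLattice.exists_coordinates_D (hB : IsRootLattice B) (hm : 4 ≤ m)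
    (hD : HasType B (CartanMatrix.D m)) :
    ∃ φ : L →ₗ[ℤ] (Fin m → ℤ), Function.Injective φ ∧ (∀ x y, B x y = φ x ⬝ᵥ φ y) ∧
      ∀ z, (∃ x, φ x = z) ↔ Even (∑ i, z i) := by
  obtain ⟨φ, hinj, hiso, hrange⟩ := hB.exists_coordinates hD (simpleRootsD m hm)
    (simpleRootsD_dotProduct m hm)
  refine ⟨φ, hinj, hiso, fun z => ?_⟩
  rw [← mem_span_simpleRootsD m hm, ← hrange]
  rfl

/-- In type `D_m` an element of order `p` cannot map all vectors `2 e_i` to vectors with even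
coordinates. -/
theorem IsRootPair.not_forall_even (hp : p.Prime) (hp2 : p ≠ 2) (hR : IsRootPair p B ρ)
    {φ : L →ₗ[ℤ] (Fin m → ℤ)} (hinj : Function.Injective φ)
    (hiso : ∀ x y, B x y = φ x ⬝ᵥ φ y) (hrange : ∀ z, (∃ x, φ x = z) ↔ Even (∑ i, z i))
    {E : Fin m → L} (hE : ∀ i, φ (E i) = (2 : ℤ) • Pi.single i 1) {g : H} (hg : orderOf g = p) :
    ¬ ∀ i k, Even (φ (ρ g (E i)) k) := by
  intro heven
  have hcop : IsCoprime (-2 : ℤ) (p : ℤ) := by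
    rw [IsCoprime.neg_left_iff]
    exact_mod_cast Nat.isCoprime_iff_coprime.mpr
      ((Nat.coprime_primes Nat.prime_two hp).mpr hp2.symm)
  have hsharp : ∀ (i) (x : L), B x x = 2 → ρ g (E i) - E i ≠ (-2 : ℤ) • x := fun i x hx h =>
    hR.smul_notMem_sharpLattice hcop hx (h ▸ Submodule.subset_span (Or.inr ⟨g, E i, rfl⟩))
  -- Even coordinates and norm 4 make the image `±2 e_j`. For `j ≠ i` the difference from `2 e_i` is
  -- -2 times a root, impossible in the sharp lattice as `p` is odd.
  have hsign : ∀ i, ρ g (E i) = E i ∨ ρ g (E i) = -E i := by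
    intro i
    choose w hw using fun k => (heven i k).two_dvd
    have hw' : φ (ρ g (E i)) = (2 : ℤ) • w := funext hw
    have hnorm : w ⬝ᵥ w = 1 := by
      have h1 := hR.isometry g (E i) (E i)
      rw [hiso, hiso, hw', hE] at h1
      simp only [smul_dotProduct, dotProduct_smul, smul_eq_mul, single_dotProduct,
        Pi.single_eq_same, mul_one] at h1
      omega
    obtain ⟨j, hj⟩ := exists_eq_single_of_dotProduct_self hnorm
    by_cases hij : i = j
    · subst hij
      rcases hj with rfl | rfl
      · exact Or.inl (hinj (by rw [hw', hE]))
      · exact Or.inr (hinj (by rw [hw', map_neg, hE, smul_neg]))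
    · exfalso
      rcases hj with rfl | rfl
      · obtain ⟨x, hx⟩ := (hrange (Pi.single i 1 - Pi.single j 1)).mpr (by simp)
        refine hsharp i x ?_ (hinj ?_)
        · rw [hiso, hx]
          simp [hij, Ne.symm hij]
        · rw [map_sub, map_smul, hw', hE, hx]
          module
      · obtain ⟨x, hx⟩ := (hrange (Pi.single i 1 + Pi.single j 1)).mpr
          (by simp [Finset.sum_add_distrib])
        refine hsharp i x ?_ (hinj ?_)
        · rw [hiso, hx]
          simp [hij, Ne.symm hij]
        · rw [map_sub, map_smul, hw', hE, hx]
          module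
  have hsq : ∀ i, ρ (g ^ 2) (E i) = E i := by
    intro i
    rw [pow_two, map_mul, LinearEquiv.mul_apply]
    rcases hsign i with h | h <;> simp [h]
  have hg2 : g ^ 2 = 1 := by
    apply hR.faithful
    rw [map_one]
    ext x
    refine hinj (funext fun i => ?_)
    have h1 := hR.isometry (g ^ 2) x (E i)
    rw [hsq, hiso, hiso, hE, dotProduct_smul, dotProduct_smul] at h1
    simpa using h1
  have := orderOf_dvd_of_pow_eq_one hg2
  rw [hg] at this
  exact hp2 ((Nat.prime_dvd_prime_iff_eq hp Nat.prime_two).mp this)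

/-- The image of `2 e_i` pairs evenly with the lattice, so its coordinates share one parity; if they
were odd, its norm 4 would be at least `m`. -/
theorem IsRootPair.not_hasType_D (hp : p.Prime) (hp2 : p ≠ 2) (hR : IsRootPair p B ρ)
    (hm : 5 ≤ m) : ¬ HasType B (CartanMatrix.D m) := by
  intro hD
  obtain ⟨φ, hinj, hiso, hrange⟩ := hR.isRootLattice.exists_coordinates_D (by omega) hD
  obtain ⟨g, hg⟩ : ∃ g : H, orderOf g = p := by
    obtain ⟨b, hb⟩ := hD
    exact hR.exists_orderOf_eq hp (α := b ⟨0, by omega⟩) (by rw [hb]; simp)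
  choose E hE using fun i : Fin m =>
    (hrange ((2 : ℤ) • Pi.single i 1)).mpr (by simp [← Finset.mul_sum])
  refine hR.not_forall_even hp hp2 hinj hiso hrange hE hg fun i => ?_
  set z := φ (ρ g (E i)) with hz
  have hnorm : z ⬝ᵥ z = 4 := by
    rw [hz, ← hiso, hR.isometry, hiso, hE, smul_dotProduct, dotProduct_smul]
    simp
  have hpar : ∀ y, Even (z ⬝ᵥ φ y) := by
    intro y
    have hy : y = ρ g (ρ g⁻¹ y) := by
      rw [← LinearEquiv.mul_apply, ← map_mul, mul_inv_cancel, map_one]; rfl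
    rw [hz, ← hiso, hy, hR.isometry, hiso, hE, smul_dotProduct]
    exact even_two_mul _
  by_contra! hodd
  obtain ⟨k, hk⟩ := hodd
  have hall : ∀ l, 1 ≤ z l * z l := by
    intro l
    obtain ⟨x, hx⟩ := (hrange (Pi.single k 1 + Pi.single l 1)).mpr
      (by simp [Finset.sum_add_distrib])
    have h1 := hpar x
    rw [hx] at h1
    simp only [dotProduct_add, dotProduct_single, mul_one] at h1
    have hne : z l ≠ 0 := by
      intro h0
      rw [h0, add_zero] at h1
      exact hk h1
    have := mul_self_pos.mpr hne
    omega
  have hcard := Finset.card_nsmul_le_sum Finset.univ (fun l => z l * z l) 1 fun l _ => hall l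
  have : ∑ l, z l * z l = 4 := hnorm
  rw [this, Finset.card_univ, Fintype.card_fin] at hcard
  simp at hcard
  omega

theorem IsRootPair.eq_three_of_hasType_D₄ (hp : p.Prime) (hp2 : p ≠ 2) (hR : IsRootPair p B ρ)
    (hD : HasType B (CartanMatrix.D 4)) : p = 3 := by
  by_contra hp3
  have hp5 : 5 ≤ p := by
    have := hp.two_le
    by_contra hlt
    have : p = 4 := by omega
    subst this
    norm_num at hp
  obtain ⟨φ, hinj, hiso, hrange⟩ := hR.isRootLattice.exists_coordinates_D le_rfl hD
  obtain ⟨g, hg⟩ : ∃ g : H, orderOf g = p := by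
    obtain ⟨b, hb⟩ := hD
    exact hR.exists_orderOf_eq hp (α := b 0) (by rw [hb]; simp)
  choose E hE using fun i : Fin 4 =>
    (hrange ((2 : ℤ) • Pi.single i 1)).mpr (by simp [← Finset.mul_sum])
  refine hR.not_forall_even hp hp2 hinj hiso hrange hE hg fun i => ?_
  let S : Subgroup H :=
    { carrier := {h | ∃ y, ρ h (E i) = E i + (2 : ℤ) • y}
      one_mem' := ⟨0, by simp⟩
      mul_mem' := by
        rintro h h' ⟨y, hy⟩ ⟨y', hy'⟩
        refine ⟨y + ρ h y', ?_⟩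
        rw [map_mul, LinearEquiv.mul_apply, hy', map_add, map_smul, hy]
        module
      inv_mem' := by
        rintro h ⟨y, hy⟩
        refine ⟨-ρ h⁻¹ y, ?_⟩
        have h1 : ρ h⁻¹ (ρ h (E i)) = E i := by
          rw [← LinearEquiv.mul_apply, ← map_mul, inv_mul_cancel, map_one]; rfl
        rw [hy, map_add, map_smul] at h1
        rw [smul_neg, ← sub_eq_add_neg]
        exact eq_sub_of_add_eq h1 }
  have hpar : ∀ (h : H) (j : Fin 4), Even (φ (ρ h (E i)) 0 - φ (ρ h (E i)) j) := by
    intro h j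
    obtain ⟨x, hx⟩ := (hrange (Pi.single 0 1 - Pi.single j 1)).mpr (by simp)
    have hy : x = ρ h (ρ h⁻¹ x) := by
      rw [← LinearEquiv.mul_apply, ← map_mul, mul_inv_cancel, map_one]; rfl
    have h1 : Even (B (ρ h (E i)) x) := by
      rw [hy, hR.isometry, hiso, hE, smul_dotProduct]
      exact even_two_mul _
    rw [hiso, hx] at h1
    simpa [dotProduct_sub] using h1
  -- The common coordinate parity and half the coordinate sum modulo 2 determine the class of an
  -- image of `2 e_i` modulo `2 L`. Among five powers of `g` two agree, and their exponent
  -- difference, below `p`, is prime to the order of `g`.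
  obtain ⟨a, c, hac, heq⟩ := Fintype.exists_ne_map_eq_of_card_lt
    (fun n : Fin 5 => (((φ (ρ (g ^ (n : ℕ)) (E i)) 0 : ℤ) : ZMod 2),
      (((∑ j, φ (ρ (g ^ (n : ℕ)) (E i)) j) / 2 : ℤ) : ZMod 2))) (by simp)
  have hS : ∀ a c : Fin 5, a < c →
      (((φ (ρ (g ^ (a : ℕ)) (E i)) 0 : ℤ) : ZMod 2),
        (((∑ j, φ (ρ (g ^ (a : ℕ)) (E i)) j) / 2 : ℤ) : ZMod 2)) =
      (((φ (ρ (g ^ (c : ℕ)) (E i)) 0 : ℤ) : ZMod 2),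
        (((∑ j, φ (ρ (g ^ (c : ℕ)) (E i)) j) / 2 : ℤ) : ZMod 2)) → g ∈ S := by
    intro a c hlt heq
    rw [Prod.mk.injEq, ZMod.intCast_eq_intCast_iff_dvd_sub, ZMod.intCast_eq_intCast_iff_dvd_sub]
      at heq
    obtain ⟨h0, hs⟩ := heq
    set x := φ (ρ (g ^ (a : ℕ)) (E i)) with hx
    set y := φ (ρ (g ^ (c : ℕ)) (E i)) with hy
    have hdvd : ∀ j, (2 : ℤ) ∣ y j - x j := by
      intro j
      obtain ⟨s, hs⟩ := hpar (g ^ (a : ℕ)) j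
      obtain ⟨t, ht⟩ := hpar (g ^ (c : ℕ)) j
      rw [← hx] at hs
      rw [← hy] at ht
      push_cast at h0
      omega
    choose w hw using hdvd
    have hex : Even (∑ j, x j) := (hrange x).mp ⟨_, rfl⟩
    have hey : Even (∑ j, y j) := (hrange y).mp ⟨_, rfl⟩
    have hwsum : ∑ j, y j - ∑ j, x j = 2 * ∑ j, w j := by
      rw [← Finset.sum_sub_distrib, Finset.mul_sum]
      exact Finset.sum_congr rfl fun j _ => hw j
    obtain ⟨u, hu⟩ := (hrange w).mpr (by
      rw [even_iff_two_dvd] at hex hey ⊢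
      push_cast at hs
      omega)
    have hstep : ρ (g ^ (c : ℕ)) (E i) = ρ (g ^ (a : ℕ)) (E i) + (2 : ℤ) • u := by
      apply hinj
      rw [map_add, map_smul, hu, ← hx, ← hy]
      ext j
      have := hw j
      simp only [Pi.add_apply, Pi.smul_apply, smul_eq_mul]
      omega
    have hmem : g ^ ((c : ℕ) - a) ∈ S := by
      refine ⟨ρ (g ^ (a : ℕ))⁻¹ u, ?_⟩
      have h1 : g ^ ((c : ℕ) - a) = (g ^ (a : ℕ))⁻¹ * g ^ (c : ℕ) := by
        rw [eq_inv_mul_iff_mul_eq, ← pow_add]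
        congr 1
        omega
      rw [h1, map_mul, LinearEquiv.mul_apply, hstep, map_add, map_smul, ← LinearEquiv.mul_apply,
        ← map_mul, inv_mul_cancel, map_one]
      rfl
    have hcop : ((c : ℕ) - a).Coprime (orderOf g) := by
      rw [hg, Nat.coprime_comm]
      exact Nat.coprime_of_lt_prime (by omega) (by omega) hp
    obtain ⟨k, hk⟩ := exists_pow_eq_self_of_coprime hcop
    rw [← hk]
    exact pow_mem hmem k
  have hgS : g ∈ S := by
    rcases lt_or_gt_of_ne hac with h | h
    · exact hS a c h heq
    · exact hS c a h heq.symm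
  obtain ⟨y, hy⟩ := hgS
  intro k
  rw [hy, map_add, map_smul, hE]
  simp only [Pi.add_apply, Pi.smul_apply, smul_eq_mul]
  exact (even_two_mul _).add (even_two_mul _)

end TypeD

/-! ### Type `A`: isometries as signed permutations -/

section TypeA

theorem castSucc_sub_succ_dotProduct (m : ℕ) (i j : Fin m) :
    (Pi.single i.castSucc 1 - Pi.single i.succ 1 : Fin (m + 1) → ℤ) ⬝ᵥ
      (Pi.single j.castSucc 1 - Pi.single j.succ 1) = CartanMatrix.A m i j := by
  obtain ⟨i, hi⟩ := i
  obtain ⟨j, hj⟩ := j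
  simp only [CartanMatrix.A, Matrix.of_apply, sub_dotProduct, single_dotProduct, one_mul,
    Pi.sub_apply, Pi.single_apply, Fin.castSucc_mk, Fin.succ_mk, Fin.mk.injEq]
  split_ifs <;> omega

theorem mem_span_castSucc_sub_succ (m : ℕ) (z : Fin (m + 1) → ℤ) :
    z ∈ Submodule.span ℤ (Set.range fun i : Fin m =>
      (Pi.single i.castSucc 1 - Pi.single i.succ 1 : Fin (m + 1) → ℤ)) ↔ ∑ i, z i = 0 := by
  set V := Submodule.span ℤ (Set.range fun i : Fin m =>
      (Pi.single i.castSucc 1 - Pi.single i.succ 1 : Fin (m + 1) → ℤ)) with hV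
  constructor
  · intro hz
    induction hz using Submodule.span_induction with
    | mem x h => obtain ⟨i, rfl⟩ := h; simp
    | zero => simp
    | add x y _ _ hx hy => simp [Finset.sum_add_distrib, hx, hy]
    | smul a x _ hx => simp [← Finset.mul_sum, hx]
  · intro hz
    have hdiff : ∀ i : Fin (m + 1), (Pi.single i 1 - Pi.single 0 1 : Fin (m + 1) → ℤ) ∈ V := by
      intro i
      induction i using Fin.induction with
      | zero => simp
      | succ i ih =>
        have h1 := V.sub_mem ih (Submodule.subset_span ⟨i, rfl⟩)
        dsimp only at h1
        convert h1 using 1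
        abel
    have hz' : z = ∑ i, z i • (Pi.single i 1 - Pi.single 0 1 : Fin (m + 1) → ℤ) := by
      simp only [smul_sub, Finset.sum_sub_distrib, ← Finset.sum_smul, hz, zero_smul, sub_zero]
      exact pi_eq_sum_univ' z
    rw [hz']
    exact sum_mem fun i _ => V.smul_mem _ (hdiff i)

/-- The minimal vectors of the dual lattice of `A_{n-1}`, scaled by `n`. -/
theorem exists_eq_smul_single_sub_one {κ : Type*} [Fintype κ] [DecidableEq κ] {n : ℤ}
    (hn : 2 ≤ n) (hcard : (Fintype.card κ : ℤ) = n) {z : κ → ℤ} (hsum : ∑ i, z i = 0)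
    (hnorm : z ⬝ᵥ z = n * (n - 1)) (hdvd : ∀ i j, n ∣ z i - z j) :
    ∃ j, z = n • Pi.single j 1 - 1 ∨ z = -(n • Pi.single j 1 - 1) := by
  have hne : Nonempty κ := by
    rw [← Fintype.card_pos_iff]
    omega
  obtain ⟨o⟩ := hne
  -- All entries of `z` are congruent modulo `n`, so `z = n y - k` with `0 ≤ k < n`.
  set k := (-z o) % n with hk
  have hk0 : 0 ≤ k := Int.emod_nonneg _ (by omega)
  have hkn : k < n := Int.emod_lt_of_pos _ (by omega)
  have hy : ∀ i, ∃ y, z i + k = n * y := by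
    intro i
    obtain ⟨c, hc⟩ := hdvd i o
    refine ⟨c - (-z o) / n, ?_⟩
    have := Int.emod_add_mul_ediv (-z o) n
    rw [← hk] at this
    linear_combination hc + this
  choose y hy using hy
  have hzy : ∀ i, z i = n * y i - k := fun i => by rw [← hy]; ring
  have hysum : ∑ i, y i = k := by
    have h1 : n * ∑ i, y i - n * k = 0 := by
      rw [← hsum, Finset.mul_sum, ← hcard]
      simp only [hzy, Finset.sum_sub_distrib, Finset.sum_const, Finset.card_univ, nsmul_eq_mul,
        hcard]
    have h2 : n * (∑ i, y i - k) = 0 := by linear_combination h1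
    rcases mul_eq_zero.mp h2 with h | h
    · omega
    · omega
  have hynorm : n * (y ⬝ᵥ y) = n - 1 + k ^ 2 := by
    have h1 : z ⬝ᵥ z = n ^ 2 * (y ⬝ᵥ y) - 2 * n * k * ∑ i, y i + n * k ^ 2 := by
      simp only [dotProduct, Finset.mul_sum]
      have : n * k ^ 2 = ∑ _i : κ, k ^ 2 := by simp [hcard]
      rw [this, ← Finset.sum_sub_distrib, ← Finset.sum_add_distrib]
      exact Finset.sum_congr rfl fun i _ => by rw [hzy]; ring
    rw [hnorm, hysum] at h1
    have h2 : n * (n * (y ⬝ᵥ y) - (n - 1 + k ^ 2)) = 0 := by linear_combination -h1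
    rcases mul_eq_zero.mp h2 with h | h
    · omega
    · omega
  have hle : k ≤ y ⬝ᵥ y := by
    rw [← hysum]
    exact Finset.sum_le_sum fun i _ => by nlinarith [Int.le_self_sq (y i)]
  -- For the integer vector `y`, its sum `k` is at most its norm; inserting this in `hynorm` gives
  -- the inequality.
  have hprod : (k - 1) * (n - 1 - k) ≤ 0 := by nlinarith
  have hcases : k = 0 ∨ k = 1 ∨ k = n - 1 := by
    by_contra! h
    have : 0 < (k - 1) * (n - 1 - k) := mul_pos (by omega) (by omega)
    omega
  rcases hcases with h | h | h
  · exfalso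
    rw [h] at hynorm
    have : n ∣ 1 := ⟨1 - y ⬝ᵥ y, by linear_combination hynorm⟩
    have := Int.le_of_dvd one_pos this
    omega
  · have hone : y ⬝ᵥ y = 1 := by
      rw [h] at hynorm
      have h2 : n * (y ⬝ᵥ y - 1) = 0 := by linear_combination hynorm
      rcases mul_eq_zero.mp h2 with h | h <;> omega
    obtain ⟨j, rfl | rfl⟩ := exists_eq_single_of_dotProduct_self hone
    · exact ⟨j, Or.inl (funext fun i => by rw [hzy, h]; simp)⟩
    · simp at hysum
      omega
  · have hone : (1 - y) ⬝ᵥ (1 - y) = 1 := by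
      have h1 : (1 - y) ⬝ᵥ (1 - y) = n - 2 * k + y ⬝ᵥ y := by
        rw [← hysum]
        simp only [dotProduct, Finset.mul_sum, Pi.sub_apply, Pi.one_apply]
        have : n = ∑ _i : κ, (1 : ℤ) := by simp [hcard]
        rw [this, ← Finset.sum_sub_distrib, ← Finset.sum_add_distrib]
        exact Finset.sum_congr rfl fun i _ => by ring
      rw [h] at hynorm h1
      have h2 : n * (y ⬝ᵥ y - (n - 1)) = 0 := by linear_combination hynorm
      rcases mul_eq_zero.mp h2 with h | h <;> omega
    have hsum' : ∑ i, (1 - y) i = 1 := by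
      simp only [Pi.sub_apply, Pi.one_apply, Finset.sum_sub_distrib, hysum, h]
      simp [hcard]
    obtain ⟨j, hj | hj⟩ := exists_eq_single_of_dotProduct_self hone
    · refine ⟨j, Or.inr (funext fun i => ?_)⟩
      have := congrFun hj i
      simp only [Pi.sub_apply, Pi.one_apply] at this
      rw [hzy, h]
      simp only [Pi.neg_apply, Pi.sub_apply, Pi.smul_apply, Pi.one_apply, smul_eq_mul, ← this]
      ring
    · rw [hj] at hsum'
      simp at hsum'

theorem IsRootLattice.exists_coordinates_A {L : Type*} [AddCommGroup L] [Module.Free ℤ L]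
    [Module.Finite ℤ L] {B : LinearMap.BilinForm ℤ L} {m : ℕ} (hB : IsRootLattice B)
    (hA : HasType B (CartanMatrix.A m)) :
    ∃ φ : L →ₗ[ℤ] (Fin (m + 1) → ℤ), Function.Injective φ ∧ (∀ x y, B x y = φ x ⬝ᵥ φ y) ∧
      ∀ z, (∃ x, φ x = z) ↔ ∑ i, z i = 0 := by
  obtain ⟨φ, hinj, hiso, hrange⟩ := hB.exists_coordinates hA _ (castSucc_sub_succ_dotProduct m)
  refine ⟨φ, hinj, hiso, fun z => ?_⟩
  rw [← mem_span_castSucc_sub_succ m, ← hrange]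
  rfl

/-- Every isometry of a lattice of type `A_m`, `m ≥ 2`, is a permutation of the coordinates up to a
sign. -/
theorem exists_sign_perm_A {L : Type*} [AddCommGroup L] [Module.Free ℤ L]
    {B : LinearMap.BilinForm ℤ L} {m : ℕ} (hm : 2 ≤ m) {φ : L →ₗ[ℤ] (Fin (m + 1) → ℤ)}
    (hinj : Function.Injective φ) (hiso : ∀ x y, B x y = φ x ⬝ᵥ φ y)
    (hrange : ∀ z, (∃ x, φ x = z) ↔ ∑ i, z i = 0) {a : Fin (m + 1) → Fin (m + 1) → L}
    (ha : ∀ i j, φ (a i j) = Pi.single i 1 - Pi.single j 1) {h : L ≃ₗ[ℤ] L}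
    (hh : ∀ x y, B (h x) (h y) = B x y) :
    ∃ (ε : ℤ) (σ : Fin (m + 1) → Fin (m + 1)), (ε = 1 ∨ ε = -1) ∧
      ∀ i j, h (a i j) = ε • a (σ i) (σ j) := by
  set n : ℤ := ((m + 1 : ℕ) : ℤ) with hn
  have hn3 : 3 ≤ n := by omega
  -- Pairings with `F i` are divisible by `n` and read off the `i`-th coordinate; isometries
  -- preserve this divisibility and the norm.
  choose F hF using fun i : Fin (m + 1) =>
    (hrange (n • Pi.single i 1 - 1)).mpr (by simp [← Finset.mul_sum, hn])
  have hFdot : ∀ i y, B (F i) y = n * φ y i := by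
    intro i y
    have h0 := (hrange (φ y)).mp ⟨y, rfl⟩
    rw [hiso, hF, sub_dotProduct, smul_dotProduct, single_dotProduct, one_dotProduct, h0]
    simp
  have hstar : ∀ i, ∃ ε : ℤ, ∃ j, (ε = 1 ∨ ε = -1) ∧ h (F i) = ε • F j := by
    intro i
    obtain ⟨j, hj⟩ := exists_eq_smul_single_sub_one (n := n) (by omega) (by simp [hn])
      ((hrange (φ (h (F i)))).mp ⟨_, rfl⟩)
      (by rw [← hiso, hh, hFdot, hF]; simp) (fun k l => by
        have h1 : φ (h (F i)) k - φ (h (F i)) l = B (h (F i)) (a k l) := by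
          rw [hiso, ha, dotProduct_sub, dotProduct_single, dotProduct_single, mul_one, mul_one]
        have h2 : a k l = h (h.symm (a k l)) := (h.apply_symm_apply _).symm
        rw [h1, h2, hh, hFdot]
        exact dvd_mul_right _ _)
    rcases hj with hj | hj
    · exact ⟨1, j, Or.inl rfl, hinj (by rw [hj, one_smul, hF])⟩
    · exact ⟨-1, j, Or.inr rfl, hinj (by rw [hj, neg_one_smul, map_neg, hF])⟩
  choose ε σ hε hσ using hstar
  -- Distinct `F i`, `F j` pair to `-n`; opposite signs would give `n` or `-n (n - 1)`, which differ
  -- from `-n` because `n ≥ 3`.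
  have hεeq : ∀ i j, ε i = ε j := by
    intro i j
    by_cases hij : i = j
    · rw [hij]
    have h1 := hh (F i) (F j)
    rw [hσ, hσ, map_smul, LinearMap.map_smul, LinearMap.smul_apply, hFdot, hFdot, hF, hF] at h1
    simp only [Pi.sub_apply, Pi.smul_apply, Pi.single_apply, Pi.one_apply, smul_eq_mul, hij,
      if_false] at h1
    rcases hε i with hi | hi <;> rcases hε j with hj | hj <;> rw [hi, hj] at h1 ⊢ <;>
      exfalso <;> split_ifs at h1 <;> nlinarith
  refine ⟨ε 0, σ, hε 0, fun i j => hinj ?_⟩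
  have hFa : ∀ i j, n • a i j = F i - F j := fun i j => hinj (by
    rw [map_smul, map_sub, ha, hF, hF]
    module)
  have h1 : n • h (a i j) = n • (ε 0 • a (σ i) (σ j)) := by
    rw [← map_smul, hFa, map_sub, hσ, hσ, hεeq i 0, hεeq j 0, smul_comm, hFa, smul_sub]
  rw [smul_right_injective L (by omega : n ≠ 0) h1]

end TypeA

/-! ### Type `A`: the action on classes modulo the sharp lattice -/

section TypeA

variable {L H : Type*} [AddCommGroup L] [Group H] {p : ℕ} {B : LinearMap.BilinForm ℤ L}
  {ρ : H →* (L ≃ₗ[ℤ] L)} {κ : Type*}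

/-- `g` acts on the family `a i j` of differences by the sign `ε` and the map `σ`. -/
def ActsBy (ρ : H →* (L ≃ₗ[ℤ] L)) (a : κ → κ → L) (g : H) (ε : ℤ) (σ : κ → κ) : Prop :=
  ∀ i j, ρ g (a i j) = ε • a (σ i) (σ j)

variable {a : κ → κ → L} {g h : H} {ε δ : ℤ} {σ τ : κ → κ}

theorem ActsBy.one : ActsBy ρ a 1 1 id := fun i j => by simp

theorem ActsBy.mul (hg : ActsBy ρ a g ε σ) (hh : ActsBy ρ a h δ τ) :
    ActsBy ρ a (g * h) (ε * δ) (σ ∘ τ) := fun i j => by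
  rw [map_mul, LinearEquiv.mul_apply, hh, map_smul, hg, smul_smul, mul_comm]
  rfl

theorem ActsBy.pow (hg : ActsBy ρ a g 1 σ) (r : ℕ) : ActsBy ρ a (g ^ r) 1 σ^[r] := by
  induction r with
  | zero => rw [pow_zero]; exact ActsBy.one
  | succ r ih =>
    have h1 := ih.mul hg
    rw [mul_one] at h1
    rwa [pow_succ, Function.iterate_succ]

variable {U : Type*} [AddCommGroup U] {f : κ → U} {ψ : L →ₗ[ℤ] U}

theorem ActsBy.sub_eq (hψ : ∀ g x, ψ (ρ g x) = ψ x) (hf : ∀ i j, f i - f j = ψ (a i j))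
    (hg : ActsBy ρ a g ε σ) (hε : ε = 1 ∨ ε = -1) (i j : κ) :
    f (σ i) - f (σ j) = ε • (f i - f j) := by
  rw [hf i j, ← hψ g, hg i j, hf, map_smul, smul_smul]
  rcases hε with rfl | rfl <;> simp

/-- As `H` acts trivially through `ψ`, an element of sign 1 translates the values of `f` by a
constant. -/
theorem ActsBy.iterate_eq (hψ : ∀ g x, ψ (ρ g x) = ψ x) (hf : ∀ i j, f i - f j = ψ (a i j))
    (hg : ActsBy ρ a g 1 σ) (i : κ) (r : ℕ) : f (σ^[r] i) = f i + r • (f (σ i) - f i) := by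
  induction r with
  | zero => simp
  | succ r ih =>
    have h1 := hg.sub_eq hψ hf (Or.inl rfl) (σ^[r] i) i
    rw [one_smul, sub_eq_iff_eq_add] at h1
    rw [Function.iterate_succ_apply', h1, ih, succ_nsmul]
    abel

/-- The elements acting with sign `1` permute the indices transitively. -/
theorem ActsBy.exists_apply_eq [Fintype H] [DecidableEq κ] (hp2 : Odd p)
    (hψ : ∀ g x, ψ (ρ g x) = ψ x) (hf : ∀ i j, f i - f j = ψ (a i j))
    (hinj : Function.Injective f) (hU : ∀ u : U, p • u = 0)
    (hact : ∀ g, ∃ (ε : ℤ) (σ : κ → κ), (ε = 1 ∨ ε = -1) ∧ ActsBy ρ a g ε σ)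
    {φ : L →ₗ[ℤ] (κ → ℤ)} (ha : ∀ i j, φ (a i j) = Pi.single i 1 - Pi.single j 1)
    (hN : ∀ i j, normMap ρ (a i j) = 0) (i k : κ) :
    ∃ g σ, ActsBy ρ a g 1 σ ∧ σ i = k := by
  -- The choice is pinned at `1` so that the identity contributes exactly 1 to the signed count at a
  -- fixed index.
  have hact' : ∀ g, ∃ (ε : ℤ) (σ : κ → κ), ((ε = 1 ∨ ε = -1) ∧ ActsBy ρ a g ε σ) ∧
      (g = 1 → ε = 1 ∧ σ = id) := by
    intro g
    by_cases hg : g = 1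
    · subst hg
      exact ⟨1, id, ⟨Or.inl rfl, ActsBy.one⟩, fun _ => ⟨rfl, rfl⟩⟩
    · obtain ⟨ε, σ, h⟩ := hact g
      exact ⟨ε, σ, h, fun h1 => absurd h1 hg⟩
  choose ε σ hεσ h1 using hact'
  -- The vanishing norm of `a i j` says that the signed number of elements sending `i` to `k` does
  -- not depend on `i`.
  have hcount : ∀ i j k, ∑ g, ε g * (if σ g i = k then 1 else 0)
      = ∑ g, ε g * (if σ g j = k then 1 else 0) := by
    intro i j k
    have h0 := congrArg (fun x => φ x k) (hN i j)
    simp only [normMap_apply, (hεσ _).2 i j, map_sum, map_smul, ha, Finset.sum_apply, map_zero,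
      Pi.smul_apply, Pi.sub_apply, Pi.single_apply, Pi.zero_apply, smul_eq_mul, mul_sub,
      Finset.sum_sub_distrib] at h0
    rw [sub_eq_zero] at h0
    simpa only [eq_comm] using h0
  -- if `i` is not moved to `k` with sign `1`, some element fixes `k` with sign `-1`
  have hfix : ∀ i k, (∀ g σ, ActsBy ρ a g 1 σ → σ i ≠ k) → ∃ g, ε g = -1 ∧ σ g k = k := by
    intro i k hik
    by_contra! hno
    have hle : ∑ g, ε g * (if σ g i = k then 1 else 0) ≤ 0 := by
      refine Finset.sum_nonpos fun g _ => ?_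
      split_ifs with hgk
      · rcases (hεσ g).1 with h | h
        · exact absurd hgk (hik g (σ g) (h ▸ (hεσ g).2))
        · rw [h]; norm_num
      · simp
    have hnn : ∀ g, 0 ≤ ε g * (if σ g k = k then 1 else 0) := by
      intro g
      split_ifs with hgk
      · rcases (hεσ g).1 with h | h
        · rw [h]; norm_num
        · exact absurd hgk (hno g h)
      · simp
    have hge := Finset.single_le_sum (f := fun g => ε g * (if σ g k = k then 1 else 0))
      (fun g _ => hnn g) (Finset.mem_univ 1)
    simp only [(h1 1 rfl).1, (h1 1 rfl).2, id_eq, if_true, mul_one] at hge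
    rw [hcount k i] at hge
    omega
  by_contra! hik
  have hki : ∀ g σ, ActsBy ρ a g 1 σ → σ k ≠ i := by
    intro g σ hg hσ
    -- The values lie in a group killed by `p`, so the power `p - 1` is the inverse translation.
    refine hik (g ^ (p - 1)) _ (hg.pow _) (hinj ?_)
    have hp : 1 ≤ p := hp2.pos
    have h2 := hg.sub_eq hψ hf (Or.inl rfl) i k
    rw [one_smul, hσ] at h2
    have h3 := hU (f i - f k)
    rw [show p = (p - 1) + 1 by omega, succ_nsmul] at h3
    rw [hg.iterate_eq hψ hf, show f (σ i) - f i = f i - f k from h2,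
      eq_neg_of_add_eq_zero_left h3]
    abel
  obtain ⟨t, ht, htk⟩ := hfix i k hik
  obtain ⟨s, hs, hsi⟩ := hfix k i hki
  -- On values of `f`, `t` and `s` are point reflections in `f k` and `f i`, so `t * s` translates
  -- by `2 (f k - f i)`. With `p = 2 q + 1`, its power `q + 1` translates by `f k - f i`.
  have hts := (hεσ t).2.mul (hεσ s).2
  rw [ht, hs, show (-1 : ℤ) * -1 = 1 by norm_num] at hts
  obtain ⟨q, hq⟩ := hp2
  refine hik _ _ (hts.pow (q + 1)) (hinj ?_)
  have h2 := (hεσ t).2.sub_eq hψ hf (hεσ t).1 i k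
  rw [htk, ht, neg_one_smul, sub_eq_iff_eq_add] at h2
  have h3 := hU (f k - f i)
  rw [hts.iterate_eq hψ hf, Function.comp_apply, hsi, h2]
  rw [hq] at h3
  have h4 : f i + (q + 1) • (-(f i - f k) + f k - f i) = f k + (2 * q + 1) • (f k - f i) := by
    module
  rw [h4, h3, add_zero]

theorem AddSubgroup.exists_card_eq_pow {U : Type*} [AddCommGroup U] (hp : p.Prime)
    (hU : ∀ u : U, p • u = 0) (T : AddSubgroup U) [Finite T] : ∃ k, Nat.card T = p ^ k := by
  have := Fact.mk hp
  have hP : IsPGroup p (Multiplicative T) := by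
    rw [isPGroup_iff_pow_pow_eq_one]
    refine fun g => ⟨1, ?_⟩
    rw [pow_one]
    exact congrArg Multiplicative.ofAdd (Subtype.ext (hU (g.toAdd : T)))
  obtain ⟨k, hk⟩ := (IsPGroup.iff_card (G := Multiplicative T)).mp hP
  exact ⟨k, hk⟩

/-- The values of `f` form a subgroup, whose order is therefore a power of `p`. -/
theorem ActsBy.exists_card_eq_pow [Finite κ] (hp : p.Prime)
    (hψ : ∀ g x, ψ (ρ g x) = ψ x) (hf : ∀ i j, f i - f j = ψ (a i j))
    (hinj : Function.Injective f) (hU : ∀ u : U, p • u = 0) {o : κ} (ho : f o = 0)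
    (htrans : ∀ i k, ∃ g σ, ActsBy ρ a g 1 σ ∧ σ i = k) : ∃ r, Nat.card κ = p ^ r := by
  let S : AddSubmonoid U :=
    { carrier := Set.range f
      zero_mem' := ⟨o, ho⟩
      add_mem' := by
        rintro _ _ ⟨i, rfl⟩ ⟨j, rfl⟩
        -- An element taking `o` to `i` translates by `f i`, so the set of values is closed under
        -- addition.
        obtain ⟨g, σ, hg, hσ⟩ := htrans o i
        refine ⟨σ j, ?_⟩
        have h1 := hg.sub_eq hψ hf (Or.inl rfl) j o
        rw [one_smul, hσ, ho, sub_zero, sub_eq_iff_eq_add] at h1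
        rw [h1, add_comm] }
  let T : AddSubgroup U :=
    { S with
      neg_mem' := by
        intro u hu
        have h1 : -u = (p - 1) • u := by
          have h2 := hU u
          rw [show p = (p - 1) + 1 by have := hp.pos; omega, succ_nsmul] at h2
          exact (eq_neg_of_add_eq_zero_left h2).symm
        change -u ∈ S
        rw [h1]
        exact S.nsmul_mem hu _ }
  have e : κ ≃ T := Equiv.ofInjective f hinj
  have : Finite T := Finite.of_equiv κ e
  rw [Nat.card_congr e]
  exact T.exists_card_eq_pow hp hU

/-- In rank one every isometry is `±1`, so an element of odd order `p` cannot act faithfully. -/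
theorem IsRootPair.not_hasType_A_one [Module.Free ℤ L] [Module.Finite ℤ L] [Finite H]
    (hp : p.Prime) (hp2 : p ≠ 2) (hR : IsRootPair p B ρ) : ¬ HasType B (CartanMatrix.A 1) := by
  rintro ⟨b, hb⟩
  have hb0 : B (b 0) (b 0) = 2 := by rw [hb]; decide
  obtain ⟨g, hg⟩ := hR.exists_orderOf_eq hp hb0
  obtain ⟨c, hc⟩ : ∃ c : ℤ, ρ g (b 0) = c • b 0 := by
    refine ⟨b.repr (ρ g (b 0)) 0, ?_⟩
    conv_lhs => rw [← b.sum_repr (ρ g (b 0))]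
    simp only [Finset.univ_unique, Fin.default_eq_zero, Finset.sum_singleton]
  have h1 := hR.isometry g (b 0) (b 0)
  rw [hc, map_smul, LinearMap.map_smul, LinearMap.smul_apply, hb0, smul_eq_mul, smul_eq_mul] at h1
  have hcc : c * c = 1 := by linarith
  have hg2 : g ^ 2 = 1 := by
    apply hR.faithful
    rw [map_one, pow_two, map_mul]
    apply b.ext'
    intro i
    rw [Subsingleton.elim i 0, LinearEquiv.mul_apply, hc, map_smul, hc, smul_smul, hcc, one_smul]
    rfl
  have hdvd := orderOf_dvd_of_pow_eq_one hg2
  rw [hg] at hdvd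
  exact hp2 ((Nat.prime_dvd_prime_iff_eq hp Nat.prime_two).mp hdvd)

theorem IsRootPair.exists_eq_pow_of_hasType_A [Module.Free ℤ L] [Module.Finite ℤ L] [Finite H]
    (hp : p.Prime) (hp2 : p ≠ 2) (hR : IsRootPair p B ρ) {m : ℕ} (hm : 1 ≤ m)
    (hA : HasType B (CartanMatrix.A m)) : ∃ k, m + 1 = p ^ k := by
  have hm2 : 2 ≤ m := by
    rcases hm.eq_or_lt with rfl | h
    · exact absurd hA (hR.not_hasType_A_one hp hp2)
    · exact h
  have := Fintype.ofFinite H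
  obtain ⟨φ, hinj, hiso, hrange⟩ := hR.isRootLattice.exists_coordinates_A hA
  choose a ha using fun i j : Fin (m + 1) =>
    (hrange (Pi.single i 1 - Pi.single j 1)).mpr (by simp)
  let ψ := (sharpLattice p ρ).mkQ
  have hsub : ∀ i j, a i 0 - a j 0 = a i j := fun i j => hinj (by
    rw [map_sub, ha, ha, ha, sub_sub_sub_cancel_right])
  have hf : ∀ i j, ψ (a i 0) - ψ (a j 0) = ψ (a i j) := fun i j => by rw [← map_sub, hsub]
  -- Equal classes would put the root `e_i - e_j` into the sharp lattice.
  have hfinj : Function.Injective fun i => ψ (a i 0) := by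
    intro i j hij
    by_contra hne
    have h1 : ψ (a i j) = 0 := by rw [← hf]; exact sub_eq_zero.mpr hij
    refine hR.no_roots (a i j) ((Submodule.Quotient.mk_eq_zero _).mp h1) ?_
    rw [hiso, ha]
    simp [hne, Ne.symm hne]
  have hψ : ∀ g x, ψ (ρ g x) = ψ x := fun g x => by
    rw [← sub_eq_zero, ← map_sub]
    exact (Submodule.Quotient.mk_eq_zero _).mpr (Submodule.subset_span (Or.inr ⟨g, x, rfl⟩))
  have hU : ∀ u : L ⧸ sharpLattice p ρ, p • u = 0 := fun u => by
    obtain ⟨x, rfl⟩ := Submodule.Quotient.mk_surjective _ u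
    rw [← natCast_zsmul]
    exact (Submodule.Quotient.mk_eq_zero _).mpr (Submodule.subset_span (Or.inl ⟨x, rfl⟩))
  have htrans := ActsBy.exists_apply_eq (hp.odd_of_ne_two hp2) hψ hf hfinj hU
    (fun g => exists_sign_perm_A hm2 hinj hiso hrange ha (hR.isometry g)) ha
    (fun i j => hR.fixed_eq_zero _ fun g => map_normMap ρ g _)
  obtain ⟨k, hk⟩ := ActsBy.exists_card_eq_pow hp hψ hf hfinj hU (o := 0)
    ((hf 0 0).symm.trans (sub_self _)) htrans
  exact ⟨k, by rw [← hk, Nat.card_eq_fintype_card, Fintype.card_fin]⟩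

end TypeA

theorem theorem1p5 {L H : Type*} [AddCommGroup L] [Module.Free ℤ L] [Module.Finite ℤ L]
    [Group H] [Finite H] (p : ℕ) (hp : p.Prime) (hp2 : p ≠ 2)
    (B : LinearMap.BilinForm ℤ L) (ρ : H →* (L ≃ₗ[ℤ] L)) (hR : IsRootPair p B ρ) :
    (∀ m : ℕ, 1 ≤ m → HasType B (CartanMatrix.A m) → ∃ k : ℕ, m + 1 = p ^ k) ∧
    (∀ m : ℕ, 5 ≤ m → ¬ HasType B (CartanMatrix.D m)) ∧
    (HasType B (CartanMatrix.D 4) → p = 3) ∧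
    (7 ≤ p → ¬ HasTypeE B ∧
      ∀ M : Submodule ℤ L, IsOrthogonalSummand B M → ¬ HasTypeE (B.restrict M)) ∧
    IsPGroup p ((weylGroup B).comap ρ) :=
  ⟨fun _ hm hA => hR.exists_eq_pow_of_hasType_A hp hp2 hm hA,
    fun _ hm => hR.not_hasType_D hp hp2 hm,
    fun hD => hR.eq_three_of_hasType_D₄ hp hp2 hD,
    fun hp7 => ⟨hR.not_hasTypeE hp hp7, fun _ hM => hR.not_hasTypeE_summand hp hp7 hM⟩,
    hR.isPGroup_comap_weylGroup hp⟩
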